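/- **Conventions.** All monoids are commutative and $\mathbb N=\{0,1,2,\dots\}$. For a monoid $M$, $\mathrm{Spec}(M)$ is the set of prime ideals of $M$ (the empty ideal is prime, $M$ itself is not), with the topology generated by the sets $D(f)=\{\mathfrak p : f\notin\mathfrak p\}$, $f\in M$, and the structure sheaf with $\mathcal O(D(f))=M_f$. A *monoid scheme* is a space with a sheaf of monoids that is locally isomorphic to some $\mathrm{Spec}(M)$; morphisms are required to be local on stalks. It is *of finite type* if it has a finite open cover by schemes $\mathrm{Spec}(M_i)$ with all $M_i$ finitely generated, and *smooth* if it is of finite type and has an open cover by schemes $\mathrm{Spec}(\mathbb N^r\times\mathbb Z^s)$ ($r,s\ge 0$ may vary). A monoid scheme $X$ is *$s$-cancellative* if for all points $x,y$ with $y\in\overline{\{x\}}$ the map $\mathcal O_{X,y}^*\to\mathcal O_{X,x}^*$ is injective. An element $a$ of a monoid $M$ is *$s$-regular* if, for all $u,v\in M$ and $m\in\mathbb N$, $a^mu=a^mv$ implies $(uv)^nu=(uv)^nv$ for some $n\in\mathbb N$; the set $S(M)$ of $s$-regular elements is a submonoid. Let $s\mathcal M_X$ be the sheaf of semi-meromorphic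 functions, whose sections are the families in $\prod_x (\mathcal O_{X,x})_{S(\mathcal O_{X,x})}$ that are locally of the form $a/b$ with $a,b$ sections of $\mathcal O_X$ and $b$ $s$-regular in every stalk, and let $s\mathcal M_X^*/\mathcal O_X^*$ be the quotient sheaf of groups of invertible elements. A sheaf $F$ of abelian groups on $X$ is *$s$-flasque* if for every open $U\subseteq X$ the restriction $F(X)\to F(U)$ has a section (a group homomorphism). A monoid scheme $X$ is *$s$-smooth* if it is of finite type, $s$-cancellative, and $s\mathcal M_X^*/\mathcal O_X^*$ is $s$-flasque. **Proposition.** 1. Being $s$-smooth is a local property: if $X$ is a monoid scheme and $(U_i)_{i\in I}$ is an open cover of $X$, then $X$ is $s$-smooth if and only if $X$ is of finite type and every open subscheme $U_i$ is $s$-smooth. If $I$ is finite, then $X$ is $s$-smooth if and only if every $U_i$ is $s$-smooth. 2. If $X$ and $Y$ are $s$-smooth monoid schemes, then their product $X\times Y$ (which exists in the category of monoid schemes) is $s$-smooth. 3. Every smooth monoid scheme is $s$-smooth. -/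

import Mathlib

universe u v

namespace MonSch

open CategoryTheory CategoryTheory.Limits TopologicalSpace Opposite AlgebraicGeometry

noncomputable section

/-! ### Colimits of commutative monoids

Stalks of sheaves of commutative monoids are colimits in `CommMonCat`. A colimit in `CommMonCat`
is the commutative quotient of the colimit in `MonCat`. -/

section Colimits

/-- The smallest congruence on a monoid with commutative quotient. -/
def commCon (A : Type u) [Monoid A] : Con A :=
  conGen fun x y => ∃ a b, x = a * b ∧ y = b * a

/-- The largest commutative quotient of a monoid. -/
abbrev CommQuot (A : Type u) [Monoid A] : Type u := (commCon A).Quotient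

instance (A : Type u) [Monoid A] : CommMonoid (CommQuot A) where
  mul_comm x y := by
    induction x using Con.induction_on
    induction y using Con.induction_on
    rename_i a b
    exact (Con.eq _).2 (ConGen.Rel.of _ _ ⟨a, b, rfl, rfl⟩)

/-- Homomorphisms to commutative monoids factor through the commutative quotient. -/
def CommQuot.lift {A : Type u} [Monoid A] {B : Type u} [CommMonoid B] (f : A →* B) :
    CommQuot A →* B :=
  (commCon A).lift f (Con.conGen_le.2 (by
    rintro x y ⟨a, b, rfl, rfl⟩
    simp [Con.ker_rel, mul_comm]))

variable {J : Type u} [Category.{u} J] (F : J ⥤ CommMonCat.{u})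

/-- The colimit cocone of a diagram of commutative monoids. -/
def commColimitCocone : Cocone F where
  pt := CommMonCat.of (CommQuot (colimit (F ⋙ forget₂ CommMonCat.{u} MonCat.{u}) : MonCat.{u}))
  ι :=
    { app := fun j => CommMonCat.ofHom
        ((Con.mk' _).comp (colimit.ι (F ⋙ forget₂ CommMonCat.{u} MonCat.{u}) j).hom)
      naturality := by
        intro j j' f
        ext x
        have := ConcreteCategory.congr_hom
          (colimit.w (F ⋙ forget₂ CommMonCat.{u} MonCat.{u}) f) x
        exact congrArg (Con.mk' _) this }

/-- A cocone of commutative monoids, regarded as a cocone of monoids. -/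
def forgetCocone (s : Cocone F) : Cocone (F ⋙ forget₂ CommMonCat.{u} MonCat.{u}) :=
  (forget₂ CommMonCat.{u} MonCat.{u}).mapCocone s

/-- `commColimitCocone` is a colimit. -/
def commColimitCoconeIsColimit : IsColimit (commColimitCocone F) where
  desc s := CommMonCat.ofHom (CommQuot.lift (A := (colimit (F ⋙ forget₂ _ _) : MonCat.{u}))
    (B := s.pt) (colimit.desc _ (forgetCocone F s)).hom)
  fac s j := by
    ext x
    exact ConcreteCategory.congr_hom (colimit.ι_desc (forgetCocone F s) j) x
  uniq s m hm := by
    have key : MonCat.ofHom (m.hom.comp (Con.mk' _)) = colimit.desc _ (forgetCocone F s) := by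
      refine colimit.hom_ext fun j => Eq.trans ?_ (colimit.ι_desc (forgetCocone F s) j).symm
      ext x
      exact ConcreteCategory.congr_hom (hm j) x
    ext x
    induction x using Con.induction_on with
    | H a => exact ConcreteCategory.congr_hom key a

instance : HasColimits CommMonCat.{u} where
  has_colimits_of_shape _ _ :=
    { has_colimit := fun F => ⟨⟨⟨_, commColimitCoconeIsColimit F⟩⟩⟩ }

end Colimits

/-! ### Sheaves of functions -/

section LocalSub

variable {X : TopCat.{u}}

/-- A local predicate on families of elements of the monoids `A x` that is closed under
multiplication: it defines a sheaf of commutative monoids. -/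
structure LocalSubmonoid (A : X → Type u) [∀ x, CommMonoid (A x)]
    extends TopCat.LocalPredicate A where
  one_mem : ∀ U : Opens X, pred (U := U) (fun _ => 1)
  mul_mem : ∀ {U : Opens X} {f g : ∀ x : U, A x}, pred f → pred g → pred (fun x => f x * g x)

/-- The monoid of sections over an open set. -/
def LocalSubmonoid.sections {A : X → Type u} [∀ x, CommMonoid (A x)] (P : LocalSubmonoid A)
    (U : Opens X) : Submonoid (∀ x : U, A x) where
  carrier := {f | P.pred f}
  one_mem' := P.one_mem U
  mul_mem' hf hg := P.mul_mem hf hg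

/-- The presheaf of sections. -/
def LocalSubmonoid.presheaf {A : X → Type u} [∀ x, CommMonoid (A x)] (P : LocalSubmonoid A) :
    TopCat.Presheaf CommMonCat.{u} X where
  obj U := CommMonCat.of (P.sections U.unop)
  map i := CommMonCat.ofHom
    { toFun := fun f => ⟨fun x => f.1 (i.unop x), P.res i.unop f.1 f.2⟩
      map_one' := rfl
      map_mul' := fun _ _ => rfl }

theorem LocalSubmonoid.isSheaf {A : X → Type u} [∀ x, CommMonoid (A x)] (P : LocalSubmonoid A) :
    P.presheaf.IsSheaf :=
  (TopCat.Presheaf.isSheaf_iff_isSheaf_comp (forget CommMonCat.{u}) _).2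
    (TopCat.subpresheafToTypes.isSheaf P.toLocalPredicate)

/-- A local predicate on families of elements of the abelian groups `A x` that is closed under the
group operations: it defines a sheaf of abelian groups. -/
structure LocalSubgroup (A : X → Type u) [∀ x, CommGroup (A x)]
    extends LocalSubmonoid A where
  inv_mem : ∀ {U : Opens X} {f : ∀ x : U, A x}, pred f → pred (fun x => (f x)⁻¹)

/-- The group of sections over an open set. -/
def LocalSubgroup.sections {A : X → Type u} [∀ x, CommGroup (A x)] (P : LocalSubgroup A)
    (U : Opens X) : Subgroup (∀ x : U, A x) where
  toSubmonoid := P.toLocalSubmonoid.sections U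
  inv_mem' hf := P.inv_mem hf

/-- The presheaf of sections. -/
def LocalSubgroup.presheaf {A : X → Type u} [∀ x, CommGroup (A x)] (P : LocalSubgroup A) :
    TopCat.Presheaf CommGrpCat.{u} X where
  obj U := CommGrpCat.of (P.sections U.unop)
  map i := CommGrpCat.ofHom
    { toFun := fun f => ⟨fun x => f.1 (i.unop x), P.res i.unop f.1 f.2⟩
      map_one' := rfl
      map_mul' := fun _ _ => rfl }

theorem LocalSubgroup.isSheaf {A : X → Type u} [∀ x, CommGroup (A x)] (P : LocalSubgroup A) :
    P.presheaf.IsSheaf :=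
  (TopCat.Presheaf.isSheaf_iff_isSheaf_comp (forget CommGrpCat.{u}) _).2
    (TopCat.subpresheafToTypes.isSheaf P.toLocalPredicate)

end LocalSub

/-! ### The spectrum of a commutative monoid -/

/-- Prime ideals of a commutative monoid. The empty ideal is prime, the unit ideal is not. -/
@[ext]
structure PrimeSpec (M : Type u) [CommMonoid M] where
  asIdeal : SemigroupIdeal M
  one_notMem : (1 : M) ∉ asIdeal
  mem_or_mem : ∀ {a b : M}, a * b ∈ asIdeal → a ∈ asIdeal ∨ b ∈ asIdeal

namespace PrimeSpec

variable {M : Type u} [CommMonoid M]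

/-- The complement of a prime ideal, a submonoid. -/
def primeCompl (p : PrimeSpec M) : Submonoid M where
  carrier := {a | a ∉ p.asIdeal}
  one_mem' := p.one_notMem
  mul_mem' ha hb hab := (p.mem_or_mem hab).elim ha hb

/-- `D(f)`, the set of prime ideals not containing `f`. -/
def basicOpen (f : M) : Set (PrimeSpec M) := {p | f ∉ p.asIdeal}

/-- The topology generated by the sets `D(f)`; since `D(f) ∩ D(g) = D(fg)`, they form a basis. -/
instance : TopologicalSpace (PrimeSpec M) :=
  TopologicalSpace.generateFrom (Set.range basicOpen)

variable (M) in
/-- The spectrum as an object of `TopCat`. -/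
abbrev Top : TopCat.{u} := TopCat.of (PrimeSpec M)

/-- The localization `M_𝔭` at a prime ideal. -/
abbrev Localizations (p : PrimeSpec M) : Type u := Localization (primeCompl p)

variable (M) in
/-- Families that are given by a single fraction `a / b`. -/
def isFractionPrelocal : TopCat.PrelocalPredicate (X := Top M) (Localizations (M := M)) where
  pred {U} f := ∃ a b : M, ∀ x : U, ∃ hb : b ∈ primeCompl x.1, f x = Localization.mk a ⟨b, hb⟩
  res := by
    rintro V U i f ⟨a, b, w⟩
    exact ⟨a, b, fun x => w ⟨x.1, i.le x.2⟩⟩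

variable (M) in
/-- Sections of the structure sheaf: families of elements of the `M_𝔭` that are locally given by
fractions of elements of `M`. -/
def structureSub : LocalSubmonoid (X := Top M) (Localizations (M := M)) where
  toLocalPredicate := (isFractionPrelocal M).sheafify
  one_mem U x := ⟨U, x.2, 𝟙 _, 1, 1, fun y => ⟨(primeCompl y.1).one_mem, Localization.mk_one.symm⟩⟩
  mul_mem := by
    intro U f g hf hg
    refine TopCat.PrelocalPredicate.sheafify_inductionOn₂' (X := Top M) (T₁ := Localizations (M := M))
      (T₂ := Localizations (M := M)) (T₃ := Localizations (M := M))
      (isFractionPrelocal M) (isFractionPrelocal M) (isFractionPrelocal M)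
      (fun a b => a * b) ?_ hf hg
    rintro U V s t ⟨a, b, h⟩ ⟨a', b', h'⟩
    refine ⟨a * a', b * b', fun x => ?_⟩
    obtain ⟨hb, e⟩ := h ⟨x, x.2.1⟩
    obtain ⟨hb', e'⟩ := h' ⟨x, x.2.2⟩
    refine ⟨(primeCompl x.1).mul_mem hb hb', ?_⟩
    exact (congrArg₂ (· * ·) e e').trans (Localization.mk_mul _ _ _ _)

end PrimeSpec

/-- `Spec M` with its structure sheaf. -/
def Spec (M : CommMonCat.{u}) : SheafedSpace CommMonCat.{u} where
  carrier := PrimeSpec.Top M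
  presheaf := (PrimeSpec.structureSub M).presheaf
  IsSheaf := (PrimeSpec.structureSub M).isSheaf

/-! ### Monoid schemes -/

/-- The open subspace `U` of `X` is isomorphic to `Spec M`. -/
def IsSpecOn (X : SheafedSpace CommMonCat.{u}) (U : Opens X) (M : CommMonCat.{u}) : Prop :=
  Nonempty (X.restrict U.isOpenEmbedding ≅ Spec M)

end

end MonSch

open CategoryTheory CategoryTheory.Limits TopologicalSpace Opposite AlgebraicGeometry

/-- A monoid scheme: a space with a sheaf of commutative monoids, locally isomorphic to spectra
of commutative monoids. -/
structure MonoidScheme extends SheafedSpace CommMonCat.{u} where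
  local_affine : ∀ x : toSheafedSpace, ∃ (U : Opens toSheafedSpace) (M : CommMonCat.{u}),
    x ∈ U ∧ MonSch.IsSpecOn toSheafedSpace U M

namespace MonSch

noncomputable section

/-- Morphisms of monoid schemes: morphisms of spaces with sheaves of monoids whose stalk maps are
local, i.e. only invertible elements are sent to invertible elements. -/
@[ext]
structure Hom (X Y : MonoidScheme.{u}) : Type u where
  hom : X.toSheafedSpace ⟶ Y.toSheafedSpace
  isLocal : ∀ x : X.toSheafedSpace, IsLocalHom (hom.hom.stalkMap x).hom

instance : Category MonoidScheme.{u} where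
  Hom := Hom
  id X := ⟨𝟙 X.toSheafedSpace, fun x => by
    constructor
    intro a ha
    exact (congrArg (fun φ : X.presheaf.stalk x ⟶ X.presheaf.stalk x => IsUnit (φ.hom a))
      (PresheafedSpace.stalkMap.id X.toPresheafedSpace x)).mp ha⟩
  comp f g := ⟨f.hom ≫ g.hom, fun x => by
    constructor
    intro a ha
    have h := PresheafedSpace.stalkMap.comp f.hom.hom g.hom.hom x
    have ha' : IsUnit (((g.hom.hom.stalkMap (f.hom.hom.base x)) ≫ f.hom.hom.stalkMap x).hom a) := by
      rw [← h]
      exact ha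
    exact (g.isLocal _).map_nonunit _ ((f.isLocal x).map_nonunit _ ha')⟩

/-- `X` has a finite open cover by spectra of finitely generated monoids. -/
def IsFiniteType (X : SheafedSpace CommMonCat.{u}) : Prop :=
  ∃ (n : ℕ) (U : Fin n → Opens X) (M : Fin n → CommMonCat.{u}),
    (⨆ i, U i) = ⊤ ∧ ∀ i, Monoid.FG (M i) ∧ IsSpecOn X (U i) (M i)

/-- Smooth monoid schemes: of finite type and covered by spectra of monoids `ℕ^r × ℤ^s`. -/
def IsSmooth (X : SheafedSpace CommMonCat.{u}) : Prop :=
  IsFiniteType X ∧ ∀ x : X, ∃ (U : Opens X) (M : CommMonCat.{u}) (r s : ℕ), x ∈ U ∧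
    Nonempty (M ≃* (Fin r → Multiplicative ℕ) × (Fin s → Multiplicative ℤ)) ∧ IsSpecOn X U M

/-- `X` is `s`-cancellative: for all points `x ⤳ y` (`x` specializes to `y`, that is, `x ≤ y`) the
map `𝒪_{X,y}ˣ → 𝒪_{X,x}ˣ` is injective. -/
def IsSCancellative (X : SheafedSpace CommMonCat.{u}) : Prop :=
  ∀ ⦃x y : X⦄ (h : x ⤳ y),
    Function.Injective (Units.map (X.presheaf.stalkSpecializes h).hom)

/-! ### Semi-meromorphic functions and `s`-divisors -/

/-- The submonoid of `s`-regular elements: those `a` such that `a ^ m * u = a ^ m * v` for some `m`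
implies `(u * v) ^ n * u = (u * v) ^ n * v` for some `n`. -/
def sRegular (M : Type u) [CommMonoid M] : Submonoid M where
  carrier := {a | ∀ (m : ℕ) (u v : M), a ^ m * u = a ^ m * v →
    ∃ n : ℕ, (u * v) ^ n * u = (u * v) ^ n * v}
  one_mem' m u v h := ⟨0, by simpa using h⟩
  mul_mem' := by
    intro a b ha hb m u v h
    obtain ⟨n, hn⟩ := ha m (b ^ m * u) (b ^ m * v) (by simpa [mul_pow, mul_assoc] using h)
    obtain ⟨k, hk⟩ := hb (m * (2 * n + 1)) ((u * v) ^ n * u) ((u * v) ^ n * v) (by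
      have e : ∀ w : M, b ^ (m * (2 * n + 1)) * ((u * v) ^ n * w) =
          (b ^ m * u * (b ^ m * v)) ^ n * (b ^ m * w) := by
        intro w
        rw [mul_mul_mul_comm (b ^ m) u, ← sq, mul_pow ((b ^ m) ^ 2), mul_mul_mul_comm, pow_mul,
          pow_succ, pow_mul, mul_assoc]
      rw [e, e, hn])
    refine ⟨(2 * n + 1) * k + n, ?_⟩
    have e : ∀ w : M, (u * v) ^ ((2 * n + 1) * k + n) * w =
        ((u * v) ^ n * u * ((u * v) ^ n * v)) ^ k * ((u * v) ^ n * w) := by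
      intro w
      rw [mul_mul_mul_comm, ← pow_add, ← pow_succ, ← two_mul, ← pow_mul, pow_add, mul_assoc]
    rw [e, e, hk]

variable (X : SheafedSpace CommMonCat.{u})

/-- The localization of the stalk `𝒪_{X,x}` at its `s`-regular elements. -/
abbrev SMerStalk (x : X) : Type u := Localization (sRegular (X.presheaf.stalk x))

/-- Families in `∏ (𝒪_{X,x})_{S(𝒪_{X,x})}` given by a single fraction `a / b` of sections of `𝒪_X`,
where `b` is `s`-regular in every stalk. -/
def isSMerFractionPrelocal : TopCat.PrelocalPredicate (X := X.carrier) (SMerStalk X) where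
  pred {U} f := ∃ a b : X.presheaf.obj (op U), ∀ x : U,
    ∃ hb : X.presheaf.germ U x.1 x.2 b ∈ sRegular (X.presheaf.stalk x.1),
      f x = Localization.mk (X.presheaf.germ U x.1 x.2 a) ⟨X.presheaf.germ U x.1 x.2 b, hb⟩
  res := by
    rintro V U i f ⟨a, b, w⟩
    refine ⟨X.presheaf.map i.op a, X.presheaf.map i.op b, fun x => ?_⟩
    obtain ⟨hb, e⟩ := w (i x)
    have ea := X.presheaf.germ_res_apply i x.1 x.2 a
    have eb := X.presheaf.germ_res_apply i x.1 x.2 b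
    have hb' : X.presheaf.germ V x.1 x.2 (X.presheaf.map i.op b) ∈
        sRegular (X.presheaf.stalk x.1) := by
      rw [eb]
      exact hb
    refine ⟨hb', e.trans ?_⟩
    congr 1
    · exact ea.symm
    · exact Subtype.ext eb.symm

/-- The sheaf `s𝓜_X` of semi-meromorphic functions: families in `∏ (𝒪_{X,x})_{S(𝒪_{X,x})}` that are
locally fractions of sections of `𝒪_X` with `s`-regular denominators. -/
def sMer : LocalSubmonoid (X := X.carrier) (SMerStalk X) where
  toLocalPredicate := (isSMerFractionPrelocal X).sheafify
  one_mem U x := ⟨U, x.2, 𝟙 _, 1, 1, fun y => by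
    have h1 : X.presheaf.germ U y.1 y.2 1 = 1 := map_one (X.presheaf.germ U y.1 y.2).hom
    refine ⟨by rw [h1]; exact one_mem _, ?_⟩
    rw [Localization.mk_eq_monoidOf_mk', eq_comm]
    exact Submonoid.LocalizationMap.mk'_self' _ ⟨_, _⟩⟩
  mul_mem := by
    intro U f g hf hg
    refine TopCat.PrelocalPredicate.sheafify_inductionOn₂' (X := X.carrier) (T₁ := SMerStalk X)
      (T₂ := SMerStalk X) (T₃ := SMerStalk X)
      (isSMerFractionPrelocal X) (isSMerFractionPrelocal X) (isSMerFractionPrelocal X)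
      (fun a b => a * b) ?_ hf hg
    intro U V s t hs ht
    obtain ⟨a, b, h⟩ := (isSMerFractionPrelocal X).res (Opens.infLELeft U V) s hs
    obtain ⟨a', b', h'⟩ := (isSMerFractionPrelocal X).res (Opens.infLERight U V) t ht
    refine ⟨a * a', b * b', fun x => ?_⟩
    obtain ⟨hb, e⟩ := h x
    obtain ⟨hb', e'⟩ := h' x
    have ma := map_mul (X.presheaf.germ (U ⊓ V) x.1 x.2).hom a a'
    have mb := map_mul (X.presheaf.germ (U ⊓ V) x.1 x.2).hom b b'
    have hbb : X.presheaf.germ (U ⊓ V) x.1 x.2 (b * b') ∈ sRegular (X.presheaf.stalk x.1) := by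
      rw [show X.presheaf.germ (U ⊓ V) x.1 x.2 (b * b') = _ from mb]
      exact mul_mem hb hb'
    refine ⟨hbb, ?_⟩
    refine (congrArg₂ (· * ·) e e').trans ?_
    refine (Localization.mk_mul _ _ _ _).trans ?_
    congr 1
    · exact ma.symm
    · exact Subtype.ext mb.symm

/-- The image of `𝒪_{X,x}ˣ` in the units of the stalk of `s𝓜_X`. -/
def unitsRange (x : X) : Subgroup (SMerStalk X x)ˣ :=
  (Units.map (Localization.monoidOf (sRegular (X.presheaf.stalk x))).toMonoidHom).range

/-- The group `s𝓜_{X,x}ˣ / 𝒪_{X,x}ˣ`. -/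
abbrev SDivStalk (x : X) : Type u := (SMerStalk X x)ˣ ⧸ unitsRange X x

/-- The value at `x` of an invertible section of `s𝓜_X`. -/
def unitValue {U : Opens X} (σ : ((sMer X).sections U)ˣ) (x : U) : (SMerStalk X x.1)ˣ :=
  Units.map ((Pi.evalMonoidHom (fun x : U => SMerStalk X x.1) x).comp
    ((sMer X).sections U).subtype) σ

/-- Families of classes represented by a single invertible section of `s𝓜_X`. -/
def isSDivPrelocal : TopCat.PrelocalPredicate (X := X.carrier) (SDivStalk X) where
  pred {U} f := ∃ σ : ((sMer X).sections U)ˣ,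
    ∀ x : U, f x = QuotientGroup.mk (unitValue X σ x)
  res := by
    rintro V U i f ⟨σ, h⟩
    refine ⟨Units.map ((sMer X).presheaf.map i.op).hom σ, fun x => ?_⟩
    refine (h (i x)).trans ?_
    rfl

/-- The quotient sheaf `s𝓜_Xˣ / 𝒪_Xˣ`: families in `∏ s𝓜_{X,x}ˣ / 𝒪_{X,x}ˣ` that are locally
represented by invertible sections of `s𝓜_X`. -/
def sDiv : LocalSubgroup (X := X.carrier) (SDivStalk X) where
  toLocalPredicate := (isSDivPrelocal X).sheafify
  one_mem U x := ⟨U, x.2, 𝟙 _, 1, fun y => by simp [unitValue]⟩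
  mul_mem := by
    intro U f g hf hg
    refine TopCat.PrelocalPredicate.sheafify_inductionOn₂' (X := X.carrier) (T₁ := SDivStalk X)
      (T₂ := SDivStalk X) (T₃ := SDivStalk X)
      (isSDivPrelocal X) (isSDivPrelocal X) (isSDivPrelocal X)
      (fun a b => a * b) ?_ hf hg
    intro U V s t hs ht
    obtain ⟨σ, h⟩ := (isSDivPrelocal X).res (Opens.infLELeft U V) s hs
    obtain ⟨τ, h'⟩ := (isSDivPrelocal X).res (Opens.infLERight U V) t ht
    refine ⟨σ * τ, fun x => ?_⟩
    refine (congrArg₂ (· * ·) (h x) (h' x)).trans ?_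
    simp [unitValue]
  inv_mem := by
    intro U f hf
    refine TopCat.PrelocalPredicate.sheafify_inductionOn' (X := X.carrier) (T := SDivStalk X)
      (isSDivPrelocal X) (fun a => a⁻¹) ?_ hf
    rintro U s ⟨σ, h⟩
    refine ⟨σ⁻¹, fun x => ?_⟩
    refine (congrArg (·⁻¹) (h x)).trans ?_
    simp [unitValue]

/-- `s`-flasque sheaves of abelian groups: for every open `U` the restriction `F(X) → F(U)` has a
section (a group homomorphism). -/
def IsSFlasque {X : TopCat.{u}} (F : TopCat.Presheaf CommGrpCat.{u} X) : Prop :=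
  ∀ U : Opens X, IsSplitEpi (F.map (homOfLE (le_top : U ≤ ⊤)).op)

/-- `s`-smooth monoid schemes: of finite type, `s`-cancellative, and with `s`-flasque sheaf
`s𝓜_Xˣ / 𝒪_Xˣ`. -/
def IsSSmooth : Prop :=
  IsFiniteType X ∧ IsSCancellative X ∧ IsSFlasque (sDiv X).presheaf

end

end MonSch

open MonSch

/-! A monoid scheme of finite type is a finite T0 space, so each point `x` has a smallest open
neighbourhood, the set of its generizations. This neighbourhood is the spectrum of the finitely
generated monoid `𝒪_{X,x}`: its points are the faces of `𝒪_{X,x}` (the complements of primes), and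
the specialization maps are localizations. Hence the scheme is encoded in its stalks and the maps
between them (`stalkSys`), and finite type is a condition on this system (`isFiniteType_iff`).

Localizations preserve `s`-regular elements, so the group `SDiv M` of `s`-divisors is functorial
along specializations, and a section of the divisor sheaf is a compatible family of elements of
these groups (`sDiv_pred_iff`). Adding missing points one at a time shows that the sheaf is
`s`-flasque if and only if every point satisfies `SplitAt`: families on any open `U` prolong,
homomorphically, to a value at `x` with the prescribed images at the generizations of `x` in `U`.
This condition and `s`-cancellativity at `x` see only the generizations of `x`, which lie in every
neighbourhood of `x`. That is why `s`-smoothness is local (`isSSmooth_iff`, `LocalIso`).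

For products, the stalk at `(x, y)` is the product of the stalks, and `SDiv (M × N)` is the product
of the two divisor groups. A family near `(x, y)` is recovered from its first components along the
slice through the generic point of the second factor and its second components along the other
slice, so splittings for the factors combine (`SplitAt.prod`). The space with these stalks is shown
to be the categorical product, and every other product is isomorphic to it.

For smooth schemes, the stalk is `ℕ^r × ℤ^s` at the closed point of a chart, and its divisor group
is generated by the classes of the `r` coordinates. The coefficient of each is read off at a point
of codimension one; a family on `U` is extended by coefficient zero at those outside `U`
(`splitAt_of_freeCoord`). -/

namespace MonSch

noncomputable section

/-! ### Localizations and `s`-regular elements -/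

section Algebra

variable {M N K : Type u} [CommMonoid M] [CommMonoid N] [CommMonoid K]

/-- `f` is a localization at the preimage of the units. -/
structure IsLoc (f : M →* N) : Prop where
  frac : ∀ n, ∃ a b, IsUnit (f b) ∧ n * f b = f a
  eq : ∀ a a', f a = f a' → ∃ b, IsUnit (f b) ∧ b * a = b * a'

/-- `f` sends `s`-regular elements to `s`-regular elements. -/
def PreservesSRegular (f : M →* N) : Prop := ∀ a ∈ sRegular M, f a ∈ sRegular N

theorem IsLoc.of_bijective {f : M →* N} (hf : Function.Bijective f) : IsLoc f where
  frac n := by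
    obtain ⟨a, rfl⟩ := hf.2 n
    exact ⟨a, 1, by simp, by simp⟩
  eq a a' h := ⟨1, by simp, by simp [hf.1 h]⟩

theorem IsLoc.comp_equiv {f : M →* N} (hf : IsLoc f) (e : K ≃* M) :
    IsLoc (f.comp e.toMonoidHom) where
  frac n := by
    obtain ⟨a, b, hb, h⟩ := hf.frac n
    exact ⟨e.symm a, e.symm b, by simpa using hb, by simpa using h⟩
  eq a a' h := by
    obtain ⟨b, hb, h⟩ := hf.eq _ _ h
    refine ⟨e.symm b, by simpa using hb, ?_⟩
    apply e.injective
    simpa using h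

theorem IsLoc.equiv_comp {f : M →* N} (hf : IsLoc f) (e : N ≃* K) :
    IsLoc (e.toMonoidHom.comp f) where
  frac n := by
    obtain ⟨a, b, hb, h⟩ := hf.frac (e.symm n)
    refine ⟨a, b, by simpa using hb, ?_⟩
    have := congrArg e h
    simpa using this
  eq a a' h := by
    obtain ⟨b, hb, h⟩ := hf.eq a a' (e.injective h)
    exact ⟨b, by simpa using hb, h⟩

theorem IsLoc.prodMap {M' N' : Type u} [CommMonoid M'] [CommMonoid N'] {f : M →* N} {g : M' →* N'}
    (hf : IsLoc f) (hg : IsLoc g) : IsLoc (f.prodMap g) where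
  frac n := by
    obtain ⟨a, b, hb, h⟩ := hf.frac n.1
    obtain ⟨a', b', hb', h'⟩ := hg.frac n.2
    exact ⟨(a, a'), (b, b'), Prod.isUnit_iff.2 ⟨hb, hb'⟩, Prod.ext h h'⟩
  eq a a' h := by
    obtain ⟨b, hb, e⟩ := hf.eq _ _ (congrArg Prod.fst h)
    obtain ⟨b', hb', e'⟩ := hg.eq _ _ (congrArg Prod.snd h)
    exact ⟨(b, b'), Prod.isUnit_iff.2 ⟨hb, hb'⟩, Prod.ext e e'⟩

/-- If `f` and `g ∘ f` are localizations, so is `g`. -/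
theorem IsLoc.of_comp {f : M →* N} {g : N →* K} (hf : IsLoc f) (hgf : IsLoc (g.comp f)) :
    IsLoc g where
  frac n := by
    obtain ⟨a, b, hb, h⟩ := hgf.frac n
    exact ⟨f a, f b, hb, h⟩
  eq a a' h := by
    obtain ⟨α, β, hβ, e⟩ := hf.frac a
    obtain ⟨α', β', hβ', e'⟩ := hf.frac a'
    -- Here `a` is `f α / f β` and `a'` is `f α' / f β'`; cross-multiplying turns the equation into
    -- one between images of elements of `M`.
    obtain ⟨b, hb, hh⟩ := hgf.eq (α * β') (α' * β) (by
      simp only [MonoidHom.comp_apply, map_mul, ← e, ← e', h]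
      exact mul_right_comm _ _ _)
    refine ⟨f b, hb, ?_⟩
    have := congrArg f hh
    simp only [map_mul, ← e, ← e'] at this
    refine (hβ.mul hβ').mul_right_cancel ?_
    calc f b * a * (f β * f β') = f b * (a * f β * f β') := by simp only [mul_assoc]
      _ = f b * (a' * f β' * f β) := this
      _ = f b * a' * (f β * f β') := by simp only [mul_assoc, mul_comm (f β')]

/-- A localization in the sense of `IsLoc` as a localization map. -/
def IsLoc.localizationMap {f : M →* N} (hf : IsLoc f) (S : Submonoid M)
    (hS : ∀ m, m ∈ S ↔ IsUnit (f m)) : S.LocalizationMap N :=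
  { f.toMulHom with
    isLocalizationMap :=
      { map_units := fun y => (hS y).1 y.2
        surj := fun z => by
          obtain ⟨a, b, hb, h⟩ := hf.frac z
          exact ⟨(a, ⟨b, (hS b).2 hb⟩), h⟩
        exists_of_eq := fun {x y} h => by
          obtain ⟨b, hb, h⟩ := hf.eq x y h
          exact ⟨⟨b, (hS b).2 hb⟩, h⟩ } }

/-- In a group everything is invertible, so no condition on `g` is needed to factor it through a
localization. -/
theorem IsLoc.exists_lift {H : Type*} [CommGroup H] {f : M →* N} (hf : IsLoc f) (g : M →* H) :
    ∃ g' : N →* H, ∀ m, g' (f m) = g m :=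
  let l := hf.localizationMap ((IsUnit.submonoid N).comap f) fun _ => Iff.rfl
  ⟨l.lift (g := g) fun _ => Group.isUnit _, fun m => l.lift_eq _ m⟩

/-- Both maps are localizations at the same submonoid, the preimage of the units. -/
theorem IsLoc.exists_equiv {f : M →* N} {g : M →* K} (hf : IsLoc f) (hg : IsLoc g)
    (h : ∀ m, IsUnit (f m) ↔ IsUnit (g m)) : ∃ e : N ≃* K, ∀ m, e (f m) = g m :=
  let S := (IsUnit.submonoid N).comap f
  let l := hf.localizationMap S fun _ => Iff.rfl
  let k := hg.localizationMap S h
  ⟨l.mulEquivOfLocalizations k, fun m => l.lift_eq _ m⟩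

theorem IsLoc.hom_ext {f : M →* N} (hf : IsLoc f) {g h : N →* K} (e : ∀ m, g (f m) = h (f m)) :
    g = h := by
  ext n
  obtain ⟨a, b, hb, hn⟩ := hf.frac n
  refine (hb.map g).mul_right_cancel ?_
  rw [← map_mul, hn, e, e b, ← map_mul, hn]

theorem IsLoc.bijective {f : M →* N} (hf : IsLoc f) (h : ∀ m, IsUnit (f m) → IsUnit m) :
    Function.Bijective f := by
  constructor
  · intro a a' e
    obtain ⟨b, hb, e⟩ := hf.eq a a' e
    exact (h b hb).mul_left_cancel e
  · intro n
    obtain ⟨a, b, hb, e⟩ := hf.frac n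
    obtain ⟨c, hc⟩ := (h b hb).exists_right_inv
    refine ⟨a * c, ?_⟩
    rw [map_mul, ← e, mul_assoc, ← map_mul, hc, map_one, mul_one]

theorem sRegular_of_mul {a b : M} (h : a * b ∈ sRegular M) : a ∈ sRegular M := by
  intro m u v e
  refine h m u v ?_
  rw [mul_pow, mul_comm (a ^ m), mul_assoc, e, mul_assoc]

theorem isUnit_sRegular {a : M} (h : IsUnit a) : a ∈ sRegular M := by
  obtain ⟨b, hb⟩ := h.exists_right_inv
  refine sRegular_of_mul (b := b) ?_
  rw [hb]
  exact one_mem _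

/-- This makes `SDiv` functorial along specializations. After clearing denominators the relation
comes from `M`, where `s`-regularity of `a` applies; the factors introduced on the way are units in
`N` and cancel. -/
theorem IsLoc.preservesSRegular {f : M →* N} (hf : IsLoc f) : PreservesSRegular f := by
  intro a ha m u v h
  obtain ⟨α, β, hβ, e⟩ := hf.frac u
  obtain ⟨α', β', hβ', e'⟩ := hf.frac v
  have hu : u * f (β * β') = f (α * β') := by rw [map_mul, map_mul, ← e, mul_assoc]
  have hv : v * f (β * β') = f (α' * β) := by
    rw [map_mul, map_mul, ← e', mul_assoc, mul_comm (f β)]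
  have hw : IsUnit (f (β * β')) := by rw [map_mul]; exact hβ.mul hβ'
  generalize β * β' = w at *
  generalize α * β' = p at *
  generalize α' * β = q at *
  -- The relation between `p` and `q` holds in `M` only after multiplication by some `c` that
  -- becomes a unit.
  obtain ⟨c, hc, hh⟩ := hf.eq (a ^ m * p) (a ^ m * q) (by
    simp only [map_mul, map_pow, ← hu, ← hv, ← mul_assoc, h])
  obtain ⟨n, hn⟩ := ha m (c * p) (c * q) (by
    rw [mul_left_comm, hh, mul_left_comm])
  refine ⟨n, ?_⟩
  have := congrArg f hn
  simp only [map_mul, map_pow, ← hu, ← hv] at this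
  -- The image of the relation for `c * p` and `c * q` carries the unit `f c * f w` exactly `2 * n +
  -- 1` times.
  refine ((((hc.mul hw).mul (hc.mul hw)).pow n).mul (hc.mul hw)).mul_right_cancel ?_
  have key : ∀ z : N, (u * v) ^ n * z * ((f c * f w * (f c * f w)) ^ n * (f c * f w)) =
      (f c * (u * f w) * (f c * (v * f w))) ^ n * (f c * (z * f w)) := by
    intro z
    have : f c * (u * f w) * (f c * (v * f w)) = (u * v) * (f c * f w * (f c * f w)) := by
      simp only [mul_assoc, mul_comm, mul_left_comm]
    rw [this, mul_pow (u * v)]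
    simp only [mul_assoc, mul_comm, mul_left_comm]
  rw [key, key, this]

/-- Projections are not localizations in general, so this is tested directly on pairs whose other
entry is `1`. -/
theorem preservesSRegular_fst : PreservesSRegular (MonoidHom.fst M N) := by
  intro a ha m u v h
  obtain ⟨n, hn⟩ := ha m (u, 1) (v, 1) (Prod.ext (by simpa using h) (by simp))
  exact ⟨n, by simpa using congrArg Prod.fst hn⟩

theorem preservesSRegular_snd : PreservesSRegular (MonoidHom.snd M N) := by
  intro a ha m u v h
  obtain ⟨n, hn⟩ := ha m (1, u) (1, v) (Prod.ext (by simp) (by simpa using h))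
  exact ⟨n, by simpa using congrArg Prod.snd hn⟩

theorem pow_eq_of_le {u v : M} {n k : ℕ} (h : (u * v) ^ n * u = (u * v) ^ n * v) (hk : n ≤ k) :
    (u * v) ^ k * u = (u * v) ^ k * v := by
  obtain ⟨d, rfl⟩ := Nat.exists_eq_add_of_le' hk
  rw [pow_add, mul_assoc, h, mul_assoc]

theorem prod_mem_sRegular {a : M} {b : N} (ha : a ∈ sRegular M) (hb : b ∈ sRegular N) :
    (a, b) ∈ sRegular (M × N) := by
  intro m u v h
  obtain ⟨n, hn⟩ := ha m u.1 v.1 (by simpa using congrArg Prod.fst h)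
  obtain ⟨k, hk⟩ := hb m u.2 v.2 (by simpa using congrArg Prod.snd h)
  exact ⟨max n k, Prod.ext (by simpa using pow_eq_of_le hn (le_max_left _ _))
    (by simpa using pow_eq_of_le hk (le_max_right _ _))⟩

theorem preservesSRegular_inl : PreservesSRegular (MonoidHom.inl M N) :=
  fun _ ha => prod_mem_sRegular ha (one_mem _)

theorem preservesSRegular_inr : PreservesSRegular (MonoidHom.inr M N) :=
  fun _ ha => prod_mem_sRegular (one_mem _) ha

theorem preservesSRegular_equiv (e : M ≃* N) : PreservesSRegular e.toMonoidHom :=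
  (IsLoc.of_bijective e.bijective).preservesSRegular

theorem PreservesSRegular.comp {f : M →* N} {g : N →* K} (hg : PreservesSRegular g)
    (hf : PreservesSRegular f) : PreservesSRegular (g.comp f) := fun a ha => hg _ (hf a ha)

/-! ### The group of `s`-divisors of a monoid -/

variable (M) in
/-- The group of units of the localization of `M` at its `s`-regular elements, modulo the units
of `M`. -/
def SDiv : Type u := (Localization (sRegular M))ˣ ⧸
  (Units.map (Localization.monoidOf (sRegular M)).toMonoidHom).range

instance : CommGroup (SDiv M) := QuotientGroup.Quotient.commGroup _

namespace SDiv

variable (M) in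
/-- The projection to the quotient. -/
def mk : (Localization (sRegular M))ˣ →* SDiv M := QuotientGroup.mk' _

theorem mk_surjective : Function.Surjective (mk M) := QuotientGroup.mk_surjective

/-- The `s`-regular elements are invertible in the localization. -/
def toUnit : sRegular M →* (Localization (sRegular M))ˣ where
  toFun x := ((Localization.monoidOf (sRegular M)).map_units x).unit
  map_one' := Units.ext (by simp)
  map_mul' x y := Units.ext (by simp)

/-- The class of an `s`-regular element. -/
def cls : sRegular M →* SDiv M := (mk M).comp toUnit

/-- If `a / b` is invertible, then `a` divides an `s`-regular element and is therefore `s`-regular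
itself. Hence `SDiv M` is generated by the classes `cls`. -/
theorem mk_eq_div (g : (Localization (sRegular M))ˣ) (a : M) (b : sRegular M)
    (h : (g : Localization (sRegular M)) = Localization.mk a b) :
    ∃ ha : a ∈ sRegular M, mk M g = cls ⟨a, ha⟩ / cls b := by
  have hg : IsUnit (Localization.mk a b) := h ▸ g.isUnit
  have ha : a ∈ sRegular M := by
    obtain ⟨c, hc⟩ := hg.exists_right_inv
    induction c using Localization.induction_on with
    | H y =>
      obtain ⟨c, d⟩ := y
      rw [Localization.mk_mul, ← Localization.mk_one, Localization.mk_eq_mk_iff,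
        Localization.r_iff_exists] at hc
      obtain ⟨t, ht⟩ := hc
      have : (t : M) * (a * c) ∈ sRegular M := by
        have e : (t : M) * (a * c) = t * ((b * d : sRegular M) : M) := by simpa using ht
        rw [e]
        exact mul_mem t.2 (b * d).2
      rw [mul_left_comm] at this
      exact sRegular_of_mul this
  refine ⟨ha, ?_⟩
  rw [eq_div_iff_mul_eq', cls, MonoidHom.comp_apply, MonoidHom.comp_apply, ← map_mul]
  refine congrArg (mk M) (Units.ext ?_)
  change (g : Localization (sRegular M)) * Localization.monoidOf (sRegular M) b =
    Localization.monoidOf (sRegular M) a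
  rw [h, Localization.mk_eq_monoidOf_mk']
  exact (Localization.monoidOf (sRegular M)).mk'_spec a b

theorem exists_eq_div (g : SDiv M) : ∃ a b, g = cls a / cls b := by
  obtain ⟨g, rfl⟩ := mk_surjective g
  obtain ⟨⟨a, b⟩, h⟩ := Localization.mkHom_surjective (S := sRegular M) (g : Localization (sRegular M))
  obtain ⟨ha, e⟩ := mk_eq_div g a b h.symm
  exact ⟨_, _, e⟩

theorem hom_ext {H : Type*} [CommGroup H] {f g : SDiv M →* H} (h : ∀ a, f (cls a) = g (cls a)) :
    f = g := by
  refine MonoidHom.ext fun x => ?_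
  obtain ⟨a, b, rfl⟩ := exists_eq_div x
  rw [map_div, map_div, h, h]

theorem cls_unit {a : M} (h : IsUnit a) (ha : a ∈ sRegular M) : cls ⟨a, ha⟩ = 1 := by
  refine (QuotientGroup.eq_one_iff _).2 ⟨h.unit, Units.ext rfl⟩

/-- A homomorphism from `M` to a group that kills the units extends to `SDiv M`. -/
def lift {H : Type*} [CommGroup H] (f : M →* H) (hf : ∀ u, IsUnit u → f u = 1) : SDiv M →* H :=
  QuotientGroup.lift _ ((toUnits.symm.toMonoidHom).comp
    (Units.map ((Localization.monoidOf (sRegular M)).lift (g := f) fun _ => Group.isUnit _))) (by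
      rintro _ ⟨u, rfl⟩
      change (Localization.monoidOf (sRegular M)).lift (g := f) (fun _ => Group.isUnit _)
        (Localization.monoidOf (sRegular M) u) = 1
      rw [Submonoid.LocalizationMap.lift_eq]
      exact hf u u.isUnit)

theorem lift_cls {H : Type*} [CommGroup H] (f : M →* H) (hf : ∀ u, IsUnit u → f u = 1)
    (a : sRegular M) : lift f hf (cls a) = f a :=
  Submonoid.LocalizationMap.lift_eq _ _ _

/-- The homomorphism induced by a homomorphism that preserves `s`-regular elements. -/
def mapOf (f : M →* N) (h : PreservesSRegular f) : SDiv M →* SDiv N :=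
  QuotientGroup.map _ _ (Units.map ((Localization.monoidOf (sRegular M)).map
    (T := sRegular N) (g := f) (fun y => h y y.2) (Localization.monoidOf (sRegular N)))) (by
    rintro _ ⟨u, rfl⟩
    refine ⟨Units.map f u, Units.ext ?_⟩
    exact ((Localization.monoidOf (sRegular M)).map_eq _ _).symm)

open Classical in
/-- The homomorphism induced by a homomorphism that preserves `s`-regular elements
(and the trivial homomorphism otherwise). -/
def map (f : M →* N) : SDiv M →* SDiv N :=
  if h : PreservesSRegular f then mapOf f h else 1

theorem map_cls {f : M →* N} (h : PreservesSRegular f) (a : sRegular M) :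
    map f (cls a) = cls ⟨f a, h a a.2⟩ := by
  rw [map, dif_pos h]
  refine congrArg (mk N) (Units.ext ?_)
  exact (Localization.monoidOf (sRegular M)).map_eq _ _

theorem map_id (g : SDiv M) : map (MonoidHom.id M) g = g := by
  have : map (MonoidHom.id M) = MonoidHom.id (SDiv M) :=
    hom_ext fun a => map_cls (fun _ h => h) a
  rw [this, MonoidHom.id_apply]

theorem map_comp {f : M →* N} {g : N →* K} (hg : PreservesSRegular g) (hf : PreservesSRegular f)
    (x : SDiv M) : map (g.comp f) x = map g (map f x) := by
  have : map (g.comp f) = (map g).comp (map f) := hom_ext fun a => by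
    rw [MonoidHom.comp_apply, map_cls hf, map_cls hg]
    exact map_cls (hg.comp hf) a
  rw [this, MonoidHom.comp_apply]

/-- An element of `N` is a fraction `f α / f β` with `f β` a unit, so it has the same class as `f
α`; `hr` provides the class of `α`. -/
theorem map_surjective {f : M →* N} (hf : IsLoc f) (hr : ∀ a : M, a ∈ sRegular M) :
    Function.Surjective (map f) := by
  have key : ∀ a : sRegular N, ∃ x, map f x = cls a := by
    intro a
    obtain ⟨α, β, hβ, e⟩ := hf.frac a
    refine ⟨cls ⟨α, hr α⟩, ?_⟩
    rw [map_cls hf.preservesSRegular]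
    have : (⟨f α, hf.preservesSRegular α (hr α)⟩ : sRegular N) = a * ⟨f β, isUnit_sRegular hβ⟩ :=
      Subtype.ext e.symm
    rw [this, map_mul, cls_unit hβ, mul_one]
  intro y
  obtain ⟨a, b, rfl⟩ := exists_eq_div y
  obtain ⟨x, hx⟩ := key a
  obtain ⟨x', hx'⟩ := key b
  exact ⟨x / x', by rw [map_div, hx, hx']⟩

/-- Since `(a, b) = (a, 1) * (1, b)`, a divisor on a product is the product of its two components.
-/
theorem inl_fst_mul_inr_snd (x : SDiv (M × N)) :
    map (MonoidHom.inl M N) (map (MonoidHom.fst M N) x) *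
      map (MonoidHom.inr M N) (map (MonoidHom.snd M N) x) = x := by
  have : ((map (MonoidHom.inl M N)).comp (map (MonoidHom.fst M N))) *
      ((map (MonoidHom.inr M N)).comp (map (MonoidHom.snd M N))) = MonoidHom.id (SDiv (M × N)) := by
    refine hom_ext fun a => ?_
    rw [MonoidHom.mul_apply, MonoidHom.comp_apply, MonoidHom.comp_apply,
      map_cls preservesSRegular_fst, map_cls preservesSRegular_snd, map_cls preservesSRegular_inl,
      map_cls preservesSRegular_inr, ← map_mul]
    refine congrArg cls (Subtype.ext ?_)
    simp
  exact DFunLike.congr_fun this x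

end SDiv

end Algebra

/-! ### Systems of monoids indexed by the points of a space -/

/-- Functorial maps between monoids attached to the points of a space, one for each
specialization `y ⤳ x`. -/
structure Specialization {P : Type u} [TopologicalSpace P] (A : P → Type u)
    [∀ p, CommMonoid (A p)] where
  map : ∀ {y x : P}, y ⤳ x → A x →* A y
  map_refl : ∀ {x : P} (h : x ⤳ x) (a : A x), map h a = a
  map_map : ∀ {z y x : P} (h : z ⤳ y) (h' : y ⤳ x) (a : A x),
    map h (map h' a) = map (h.trans h') a

namespace Specialization

section Basic

variable {P : Type u} [TopologicalSpace P] {A : P → Type u} [∀ p, CommMonoid (A p)]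
  (σ : Specialization A)

/-- Locally at `x`, the system looks like the stalks on the spectrum of the finitely generated
monoid `A x`: generizations of `x` correspond to faces of `A x`, and the maps are localizations. -/
structure IsAffineAt (x : P) : Prop where
  fg : Monoid.FG (A x)
  loc : ∀ {y : P} (h : y ⤳ x), IsLoc (σ.map h)
  specializes : ∀ {y z : P} (hy : y ⤳ x) (hz : z ⤳ x),
    (∀ m, IsUnit (σ.map hz m) → IsUnit (σ.map hy m)) → y ⤳ z
  face : ∀ F : Submonoid (A x), (∀ a b, a * b ∈ F → a ∈ F) →
    ∃ (y : P) (h : y ⤳ x), ∀ m, m ∈ F ↔ IsUnit (σ.map h m)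

/-- Units inject into the units at all generizations of `x`. -/
def IsSCancellativeAt (x : P) : Prop :=
  ∀ ⦃y : P⦄ (h : y ⤳ x), Function.Injective (Units.map (σ.map h))

/-- The compatible families of elements of the groups of `s`-divisors. -/
def divFamilies (U : Opens P) : Subgroup (∀ y : U, SDiv (A y.1)) where
  carrier := {g | ∀ (y z : U) (h : y.1 ⤳ z.1), SDiv.map (σ.map h) (g z) = g y}
  one_mem' y z h := map_one _
  mul_mem' {f g} hf hg y z h := by
    rw [Pi.mul_apply, Pi.mul_apply, map_mul, hf y z h, hg y z h]
  inv_mem' {f} hf y z h := by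
    rw [Pi.inv_apply, Pi.inv_apply, map_inv, hf y z h]

/-- The value of a family at a point. -/
def divEval (U : Opens P) (y : U) : σ.divFamilies U →* SDiv (A y.1) :=
  (Pi.evalMonoidHom (fun y : U => SDiv (A y.1)) y).comp (σ.divFamilies U).subtype

/-- Compatible families on an open set extend to `x`, in a way that is a group homomorphism. -/
def SplitAt (x : P) : Prop := ∀ U : Opens P, ∃ s : σ.divFamilies U →* SDiv (A x),
  ∀ (g : σ.divFamilies U) (y : U) (h : y.1 ⤳ x), SDiv.map (σ.map h) (s g) = g.1 y

/-- The stalk systems of monoid schemes of finite type. -/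
structure IsCombinatorial : Prop where
  finite : Finite P
  t0 : T0Space P
  affine : ∀ x, σ.IsAffineAt x

variable {σ}

theorem divMap_refl {x : P} (h : x ⤳ x) (g : SDiv (A x)) : SDiv.map (σ.map h) g = g := by
  have : σ.map h = MonoidHom.id (A x) := MonoidHom.ext fun a => σ.map_refl h a
  rw [this, SDiv.map_id]

theorem map_comp_map {z y x : P} (h : z ⤳ y) (h' : y ⤳ x) :
    (σ.map h).comp (σ.map h') = σ.map (h.trans h') :=
  MonoidHom.ext fun a => σ.map_map h h' a

theorem IsAffineAt.loc_of_specializes {x y z : P} (hx : σ.IsAffineAt x) (hy : y ⤳ x)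
    (h : z ⤳ y) : IsLoc (σ.map h) :=
  IsLoc.of_comp (hx.loc hy) (by rw [map_comp_map]; exact hx.loc _)

theorem divMap_map {z y x : P} (h : z ⤳ y) (h' : y ⤳ x) (hp : IsLoc (σ.map h))
    (hp' : IsLoc (σ.map h')) (g : SDiv (A x)) :
    SDiv.map (σ.map h) (SDiv.map (σ.map h') g) = SDiv.map (σ.map (h.trans h')) g := by
  rw [← SDiv.map_comp hp.preservesSRegular hp'.preservesSRegular, map_comp_map]

/-- Restriction of families. -/
def divRes {U V : Opens P} (h : U ≤ V) : σ.divFamilies V →* σ.divFamilies U where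
  toFun g := ⟨fun y => g.1 ⟨y.1, h y.2⟩, fun y z hyz => g.2 ⟨y.1, h y.2⟩ ⟨z.1, h z.2⟩ hyz⟩
  map_one' := rfl
  map_mul' _ _ := rfl

/-- If families extend to single points then they extend to the whole space. -/
theorem exists_section [Finite P] [T0Space P] (hσ : ∀ x, σ.SplitAt x) (U : Opens P) :
    ∃ s : σ.divFamilies U →* σ.divFamilies ⊤, ∀ g, divRes le_top (s g) = g := by
  -- Induction on the number of points outside `U`.
  induction hn : ((U : Set P)ᶜ).ncard using Nat.strong_induction_on generalizing U with
  | _ n ih =>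
  by_cases hU : U = ⊤
  · subst hU
    exact ⟨MonoidHom.id _, fun g => rfl⟩
  have hne : Nonempty ((U : Set P)ᶜ : Set P) := by
    rw [Set.nonempty_coe_sort, Set.nonempty_compl]
    exact fun h => hU (Opens.ext h)
  -- A nonempty finite T0 space has an open point. Applied to the complement of `U`, this gives a
  -- point `x` for which `U ∪ {x}` is open; this set is `V` below.
  obtain ⟨x, hx⟩ := exists_open_singleton_of_finite (X := ((U : Set P)ᶜ : Set P))
  obtain ⟨W, hW, hWx⟩ := isOpen_induced_iff.1 hx
  have hmem : ∀ y, y ∈ W → y ∉ U → y = x := fun y hy hyU => by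
    have : (⟨y, hyU⟩ : ((U : Set P)ᶜ : Set P)) ∈ Subtype.val ⁻¹' W := hy
    rw [hWx] at this
    exact congrArg Subtype.val this
  have hxW : x.1 ∈ W := by
    have : x ∈ Subtype.val ⁻¹' W := hWx ▸ rfl
    exact this
  let V : Opens P := U ⊔ ⟨W, hW⟩
  have hUV : U ≤ V := le_sup_left
  have hlt : ((V : Set P)ᶜ).ncard < n := by
    rw [← hn]
    refine Set.ncard_lt_ncard ?_ (Set.toFinite _)
    refine (Set.ssubset_iff_of_subset (Set.compl_subset_compl.2 hUV)).2 ⟨x, x.2, ?_⟩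
    exact fun h => h (Or.inr hxW)
  obtain ⟨s, hs⟩ := ih _ hlt V rfl
  choose t ht using fun x => hσ x U
  -- At a point of `U` the prolongation has no choice but to return the given value.
  have htU : ∀ g (y : U), t y g = g.1 y := fun g y => by
    rw [← ht y g y specializes_rfl, divMap_refl]
  let e : σ.divFamilies U →* σ.divFamilies V :=
    { toFun := fun g => ⟨fun y => t y g, fun y z h => by
        by_cases hy : y.1 ∈ U
        · exact (ht z g ⟨y.1, hy⟩ h).trans (htU g ⟨y.1, hy⟩).symm
        · have hz : z.1 ∉ U := fun hz => hy (h.mem_open U.2 hz)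
          have e1 := hmem y (y.2.resolve_left hy) hy
          have e2 := hmem z (z.2.resolve_left hz) hz
          obtain rfl : y = z := Subtype.ext (e1.trans e2.symm)
          exact divMap_refl h _⟩
      map_one' := Subtype.ext (funext fun y => map_one (t y))
      map_mul' := fun a b => Subtype.ext (funext fun y => map_mul (t y) a b) }
  refine ⟨s.comp e, fun g => Subtype.ext (funext fun y => ?_)⟩
  have := congrFun (congrArg Subtype.val (hs (e g))) ⟨y.1, hUV y.2⟩
  exact this.trans (htU g y)

theorem splitAt_of_section (h : ∀ U : Opens P,
      ∃ s : σ.divFamilies U →* σ.divFamilies ⊤, ∀ g, divRes le_top (s g) = g) (x : P) :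
    σ.SplitAt x := by
  intro U
  obtain ⟨s, hs⟩ := h U
  refine ⟨(σ.divEval ⊤ ⟨x, trivial⟩).comp s, fun g y hy => ?_⟩
  refine ((s g).2 ⟨y.1, trivial⟩ ⟨x, trivial⟩ hy).trans ?_
  exact congrFun (congrArg Subtype.val (hs g)) y

/-- Prolong to `x` and restrict to `y`. It therefore suffices to check the condition at the closed
point of an affine chart. -/
theorem SplitAt.of_specializes {x y : P} (h : σ.SplitAt x) (hx : σ.IsAffineAt x)
    (hy : y ⤳ x) : σ.SplitAt y := by
  intro U
  obtain ⟨s, hs⟩ := h U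
  refine ⟨(SDiv.map (σ.map hy)).comp s, fun g z hz => ?_⟩
  rw [MonoidHom.comp_apply, divMap_map _ _ (hx.loc_of_specializes hy hz) (hx.loc hy)]
  exact hs g z _

/-- The generic point of the affine neighbourhood. -/
theorem IsAffineAt.exists_generic {x : P} (hx : σ.IsAffineAt x) :
    ∃ y, y ⤳ x ∧ ∀ z, z ⤳ x → y ⤳ z := by
  -- The whole monoid is a face, complementary to the empty prime ideal; it corresponds to the
  -- generic point.
  obtain ⟨y, hy, h⟩ := hx.face ⊤ (fun _ _ _ => trivial)
  exact ⟨y, hy, fun z hz => hx.specializes hy hz fun m _ => (h m).1 trivial⟩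

end Basic

/-! ### Transfer along open embeddings -/

section Transfer

variable {P Q : Type u} [TopologicalSpace P] [TopologicalSpace Q]
  {A : P → Type u} [∀ p, CommMonoid (A p)] {B : Q → Type u} [∀ p, CommMonoid (B p)]

/-- An open embedding together with an isomorphism of systems of monoids. -/
structure LocalIso (σ : Specialization A) (τ : Specialization B) where
  toFun : P → Q
  isOpenEmbedding : Topology.IsOpenEmbedding toFun
  equiv : ∀ p, B (toFun p) ≃* A p
  equiv_map : ∀ {y x : P} (h : y ⤳ x) (b : B (toFun x)),
    equiv y (τ.map (h.map isOpenEmbedding.continuous) b) = σ.map h (equiv x b)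

namespace LocalIso

variable {σ : Specialization A} {τ : Specialization B} (j : LocalIso σ τ)

include j in
theorem specializes_iff {y x : P} : j.toFun y ⤳ j.toFun x ↔ y ⤳ x :=
  j.isOpenEmbedding.isInducing.specializes_iff

theorem exists_eq {q : Q} {x : P} (h : q ⤳ j.toFun x) : ∃ y, j.toFun y = q ∧ y ⤳ x := by
  obtain ⟨y, rfl⟩ := h.mem_open j.isOpenEmbedding.isOpen_range ⟨x, rfl⟩
  exact ⟨y, rfl, j.specializes_iff.1 h⟩

theorem map_eq {y x : P} (h : j.toFun y ⤳ j.toFun x) :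
    τ.map h = ((j.equiv y).symm.toMonoidHom.comp (σ.map (j.specializes_iff.1 h))).comp
      (j.equiv x).toMonoidHom := by
  ext b
  simp [← j.equiv_map]

theorem map_eq' {y x : P} (h : y ⤳ x) :
    σ.map h = ((j.equiv y).toMonoidHom.comp (τ.map (j.specializes_iff.2 h))).comp
      (j.equiv x).symm.toMonoidHom := by
  ext b
  simp [j.equiv_map h]

theorem isUnit_iff {y x : P} (h : y ⤳ x) (b : B (j.toFun x)) :
    IsUnit (τ.map (j.specializes_iff.2 h) b) ↔ IsUnit (σ.map h (j.equiv x b)) := by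
  rw [← j.equiv_map h, MulEquiv.isUnit_map]

/-- The condition speaks only of generizations of the point, and these all lie in the open image of
the embedding. -/
theorem isAffineAt (x : P) (hx : σ.IsAffineAt x) : τ.IsAffineAt (j.toFun x) where
  fg := @Monoid.fg_of_surjective _ _ _ _ hx.fg (j.equiv x).symm.toMonoidHom (j.equiv x).symm.surjective
  loc {q} h := by
    obtain ⟨y, rfl, hy⟩ := j.exists_eq h
    rw [j.map_eq]
    exact ((hx.loc hy).equiv_comp (j.equiv y).symm).comp_equiv _
  specializes {q r} hq hr H := by
    obtain ⟨y, rfl, hy⟩ := j.exists_eq hq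
    obtain ⟨z, rfl, hz⟩ := j.exists_eq hr
    refine j.specializes_iff.2 (hx.specializes hy hz fun m => ?_)
    obtain ⟨m, rfl⟩ := (j.equiv x).surjective m
    rw [← j.isUnit_iff, ← j.isUnit_iff]
    exact H m
  face F hF := by
    obtain ⟨y, h, hy⟩ := hx.face (F.comap (j.equiv x).symm.toMonoidHom) fun a b hab =>
      hF _ ((j.equiv x).symm b) (by simpa using hab)
    refine ⟨j.toFun y, j.specializes_iff.2 h, fun m => ?_⟩
    rw [j.isUnit_iff h, ← hy]
    simp

theorem isAffineAt' (x : P) (hx : τ.IsAffineAt (j.toFun x)) : σ.IsAffineAt x where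
  fg := @Monoid.fg_of_surjective _ _ _ _ hx.fg (j.equiv x).toMonoidHom (j.equiv x).surjective
  loc {y} h := by
    rw [j.map_eq']
    exact ((hx.loc (j.specializes_iff.2 h)).equiv_comp (j.equiv y)).comp_equiv _
  specializes {y z} hy hz H := by
    refine j.specializes_iff.1 (hx.specializes (j.specializes_iff.2 hy) (j.specializes_iff.2 hz)
      fun m => ?_)
    rw [j.isUnit_iff, j.isUnit_iff]
    exact H _
  face F hF := by
    obtain ⟨q, h, hq⟩ := hx.face (F.comap (j.equiv x).toMonoidHom) fun a b hab =>
      hF _ (j.equiv x b) (by simpa using hab)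
    obtain ⟨y, rfl, hy⟩ := j.exists_eq h
    refine ⟨y, hy, fun m => ?_⟩
    obtain ⟨m, rfl⟩ := (j.equiv x).surjective m
    rw [← j.isUnit_iff, ← hq]
    simp

theorem isSCancellativeAt_iff (x : P) :
    τ.IsSCancellativeAt (j.toFun x) ↔ σ.IsSCancellativeAt x := by
  constructor
  · intro H y h u v huv
    have := @H _ (j.specializes_iff.2 h) (Units.map (j.equiv x).symm.toMonoidHom u)
      (Units.map (j.equiv x).symm.toMonoidHom v) (Units.ext ((j.equiv y).injective (by
        have := congrArg Units.val huv
        simpa [j.equiv_map h] using this)))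
    have := congrArg Units.val this
    exact Units.ext ((j.equiv x).symm.injective this)
  · intro H q h u v huv
    obtain ⟨y, rfl, hy⟩ := j.exists_eq h
    have := @H _ hy (Units.map (j.equiv x).toMonoidHom u)
      (Units.map (j.equiv x).toMonoidHom v) (Units.ext (by
        have := congrArg (j.equiv y) (congrArg Units.val huv)
        simpa [j.equiv_map hy] using this))
    have := congrArg Units.val this
    exact Units.ext ((j.equiv x).injective this)

theorem divMap_equiv {y x : P} (h : y ⤳ x) (hl : IsLoc (σ.map h)) (hl' : IsLoc (τ.map (j.specializes_iff.2 h)))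
    (g : SDiv (B (j.toFun x))) :
    SDiv.map (σ.map h) (SDiv.map (j.equiv x).toMonoidHom g) =
      SDiv.map (j.equiv y).toMonoidHom (SDiv.map (τ.map (j.specializes_iff.2 h)) g) := by
  rw [← SDiv.map_comp hl.preservesSRegular (preservesSRegular_equiv _),
    ← SDiv.map_comp (preservesSRegular_equiv _) hl'.preservesSRegular]
  congr 1
  exact congrArg SDiv.map (MonoidHom.ext fun b => (j.equiv_map h b).symm)

theorem divMap_symm_apply (x : P) (g : SDiv (A x)) :
    SDiv.map (j.equiv x).toMonoidHom (SDiv.map (j.equiv x).symm.toMonoidHom g) = g := by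
  rw [← SDiv.map_comp (preservesSRegular_equiv _) (preservesSRegular_equiv _)]
  have : (j.equiv x).toMonoidHom.comp (j.equiv x).symm.toMonoidHom = MonoidHom.id _ := by
    ext; simp
  rw [this, SDiv.map_id]

theorem divMap_apply_symm (x : P) (g : SDiv (B (j.toFun x))) :
    SDiv.map (j.equiv x).symm.toMonoidHom (SDiv.map (j.equiv x).toMonoidHom g) = g := by
  rw [← SDiv.map_comp (preservesSRegular_equiv _) (preservesSRegular_equiv _)]
  have : (j.equiv x).symm.toMonoidHom.comp (j.equiv x).toMonoidHom = MonoidHom.id _ := by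
    ext; simp
  rw [this, SDiv.map_id]

theorem divMap_equiv_symm {y x : P} (h : y ⤳ x) (hl : IsLoc (σ.map h))
    (hl' : IsLoc (τ.map (j.specializes_iff.2 h))) (g : SDiv (A x)) :
    SDiv.map (τ.map (j.specializes_iff.2 h)) (SDiv.map (j.equiv x).symm.toMonoidHom g) =
      SDiv.map (j.equiv y).symm.toMonoidHom (SDiv.map (σ.map h) g) := by
  conv_rhs => rw [← j.divMap_symm_apply x g, j.divMap_equiv h hl hl', j.divMap_apply_symm]

theorem splitAt (hσ : ∀ x, σ.IsAffineAt x) (x : P) (hx : σ.SplitAt x) : τ.SplitAt (j.toFun x) := by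
  have hτ := fun x => j.isAffineAt x (hσ x)
  intro U
  let V : Opens P := ⟨j.toFun ⁻¹' U, U.2.preimage j.isOpenEmbedding.continuous⟩
  let r : τ.divFamilies U →* σ.divFamilies V :=
    { toFun := fun g => ⟨fun y => SDiv.map (j.equiv y.1).toMonoidHom (g.1 ⟨j.toFun y.1, y.2⟩),
        fun y z h => by
          rw [j.divMap_equiv h ((hσ _).loc h) ((hτ _).loc _)]
          exact congrArg _ (g.2 ⟨j.toFun y.1, y.2⟩ ⟨j.toFun z.1, z.2⟩ (j.specializes_iff.2 h))⟩
      map_one' := Subtype.ext (funext fun y => map_one _)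
      map_mul' := fun a b => Subtype.ext (funext fun y => map_mul _ _ _) }
  obtain ⟨s, hs⟩ := hx V
  refine ⟨(SDiv.map (j.equiv x).symm.toMonoidHom).comp (s.comp r), ?_⟩
  rintro g ⟨q, hq⟩ h
  obtain ⟨y, rfl, hy⟩ := j.exists_eq h
  rw [MonoidHom.comp_apply, MonoidHom.comp_apply,
    j.divMap_equiv_symm hy ((hσ _).loc hy) ((hτ _).loc _), hs (r g) ⟨y, hq⟩ hy]
  exact j.divMap_apply_symm _ _

theorem splitAt' (hσ : ∀ x, σ.IsAffineAt x) (x : P) (hx : τ.SplitAt (j.toFun x)) : σ.SplitAt x := by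
  have hτ := fun x => j.isAffineAt x (hσ x)
  intro U
  let V : Opens Q := ⟨j.toFun '' U, j.isOpenEmbedding.isOpenMap _ U.2⟩
  -- A point `q` of the image equals `j.toFun (p q)` only propositionally. The monoids are
  -- transported along the specializations `hp` and `hp'` between these equal points instead of by
  -- casts.
  choose p hpU hpq using fun q : V => q.2
  have hp : ∀ q : V, q.1 ⤳ j.toFun (p q) := fun q => specializes_of_eq (hpq q).symm
  have hp' : ∀ q : V, j.toFun (p q) ⤳ q.1 := fun q => specializes_of_eq (hpq q)
  let r : σ.divFamilies U →* τ.divFamilies V :=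
    { toFun := fun g => ⟨fun q => SDiv.map (τ.map (hp q))
          (SDiv.map (j.equiv (p q)).symm.toMonoidHom (g.1 ⟨p q, hpU q⟩)),
        fun q q' h => by
          have h1 : j.toFun (p q) ⤳ j.toFun (p q') := (hp' q).trans (h.trans (hp q'))
          have h2 := j.specializes_iff.1 h1
          beta_reduce
          rw [divMap_map h (hp q') ((hτ _).loc_of_specializes (hp q') h) ((hτ _).loc _),
            ← g.2 ⟨p q, hpU q⟩ ⟨p q', hpU q'⟩ h2,
            ← j.divMap_equiv_symm h2 ((hσ _).loc _) ((hτ _).loc _),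
            divMap_map _ _ ((hτ _).loc _) ((hτ _).loc _)]⟩
      map_one' := Subtype.ext (funext fun q => by
        simp only [Subgroup.coe_one, Pi.one_apply, map_one])
      map_mul' := fun a b => Subtype.ext (funext fun q => by
        simp only [Subgroup.coe_mul, Pi.mul_apply, map_mul]) }
  obtain ⟨s, hs⟩ := hx V
  refine ⟨(SDiv.map (j.equiv x).toMonoidHom).comp (s.comp r), fun g y h => ?_⟩
  rw [MonoidHom.comp_apply, MonoidHom.comp_apply, j.divMap_equiv h ((hσ _).loc h) ((hτ _).loc _)]
  have hyV : j.toFun y.1 ∈ V := ⟨y.1, y.2, rfl⟩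
  rw [hs (r g) ⟨j.toFun y.1, hyV⟩]
  have h1 : y.1 ⤳ p ⟨j.toFun y.1, hyV⟩ := j.specializes_iff.1 (hp ⟨j.toFun y.1, hyV⟩)
  change SDiv.map _ (SDiv.map (τ.map (hp ⟨j.toFun y.1, hyV⟩)) _) = _
  rw [j.divMap_equiv_symm h1 ((hσ _).loc h1) ((hτ _).loc _), j.divMap_symm_apply]
  exact g.2 y ⟨_, hpU _⟩ h1

include j in
theorem isCombinatorial' (h : τ.IsCombinatorial) : σ.IsCombinatorial where
  finite := by
    have := h.finite
    exact Finite.of_injective _ j.isOpenEmbedding.injective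
  t0 := by
    have := h.t0
    exact j.isOpenEmbedding.isEmbedding.t0Space
  affine x := j.isAffineAt' x (h.affine _)

end LocalIso

/-- Inseparable points lie in a common chart because charts are open, so T0 is checked in charts;
finiteness of the cover gives finiteness of the space. -/
theorem IsCombinatorial.of_cover {ι : Type*} [Finite ι] {P : ι → Type u}
    [∀ i, TopologicalSpace (P i)] {A : ∀ i, P i → Type u} [∀ i p, CommMonoid (A i p)]
    {σ : ∀ i, Specialization (A i)} {τ : Specialization B} (j : ∀ i, LocalIso (σ i) τ)
    (hcov : ∀ x, ∃ i p, (j i).toFun p = x) (hS : ∀ i, (σ i).IsCombinatorial) :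
    τ.IsCombinatorial := by
  refine ⟨?_, ⟨fun x y hxy => ?_⟩, fun x => ?_⟩
  · have := fun i => (hS i).finite
    refine Finite.of_surjective (fun z : Σ i, P i => (j z.1).toFun z.2) fun x => ?_
    obtain ⟨i, p, h⟩ := hcov x
    exact ⟨⟨i, p⟩, h⟩
  · obtain ⟨i, p, rfl⟩ := hcov x
    obtain ⟨q, rfl, hq⟩ := (j i).exists_eq hxy.specializes'
    have := (hS i).t0
    have hpq : p = q := ((j i).isOpenEmbedding.isInducing.inseparable_iff.1 hxy).eq
    rw [hpq]
  · obtain ⟨i, p, rfl⟩ := hcov x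
    exact (j i).isAffineAt p ((hS i).affine p)

end Transfer

end Specialization

namespace Specialization

/-! ### Products -/

section Prod

variable {P Q : Type u} [TopologicalSpace P] [TopologicalSpace Q]
  {A : P → Type u} [∀ p, CommMonoid (A p)] {B : Q → Type u} [∀ p, CommMonoid (B p)]

/-- The product of two systems of monoids. -/
def prod (σ : Specialization A) (τ : Specialization B) :
    Specialization (fun p : P × Q => A p.1 × B p.2) where
  map h := (σ.map (specializes_prod.1 h).1).prodMap (τ.map (specializes_prod.1 h).2)
  map_refl _ _ := Prod.ext (σ.map_refl _ _) (τ.map_refl _ _)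
  map_map _ _ _ := Prod.ext (σ.map_map _ _ _) (τ.map_map _ _ _)

variable {σ : Specialization A} {τ : Specialization B}

/-- Every face of a product of monoids is a product of faces, since a face contains `(a, b)` if and
only if it contains `(a, 1)` and `(1, b)`. -/
theorem IsAffineAt.prod {x : P} {y : Q} (hx : σ.IsAffineAt x) (hy : τ.IsAffineAt y) :
    (σ.prod τ).IsAffineAt (x, y) where
  fg := by
    have := hx.fg
    have := hy.fg
    exact inferInstanceAs (Monoid.FG (A x × B y))
  loc h := (hx.loc _).prodMap (hy.loc _)
  specializes {p q} hp hq H := by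
    have h1 := specializes_prod.1 hp
    have h2 := specializes_prod.1 hq
    refine specializes_prod.2 ⟨hx.specializes h1.1 h2.1 fun m hm => ?_,
      hy.specializes h1.2 h2.2 fun m hm => ?_⟩
    · exact (Prod.isUnit_iff.1 (H (m, 1) (Prod.isUnit_iff.2
        ⟨hm, by rw [show ((σ.prod τ).map hq (m, 1)).2 = 1 from map_one (τ.map h2.2)]; exact isUnit_one⟩))).1
    · exact (Prod.isUnit_iff.1 (H (1, m) (Prod.isUnit_iff.2
        ⟨by rw [show ((σ.prod τ).map hq (1, m)).1 = 1 from map_one (σ.map h2.1)]; exact isUnit_one, hm⟩))).2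
  face F hF := by
    obtain ⟨x', hx', h1⟩ := hx.face (F.comap (MonoidHom.inl _ _)) fun a b hab =>
      hF _ (b, 1) (by simpa using hab)
    obtain ⟨y', hy', h2⟩ := hy.face (F.comap (MonoidHom.inr _ _)) fun a b hab =>
      hF _ (1, b) (by simpa using hab)
    refine ⟨(x', y'), specializes_prod.2 ⟨hx', hy'⟩, fun m => ?_⟩
    refine Iff.trans ?_ (Prod.isUnit_iff.trans (and_congr (h1 m.1).symm (h2 m.2).symm)).symm
    have e : m = (m.1, 1) * (1, m.2) := by simp
    refine ⟨fun h => ⟨hF (m.1, 1) (1, m.2) (e ▸ h), hF (1, m.2) (m.1, 1) ?_⟩, fun h => ?_⟩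
    · rw [mul_comm]
      exact e ▸ h
    · rw [e]
      exact mul_mem h.1 h.2

theorem IsCombinatorial.prod (hσ : σ.IsCombinatorial) (hτ : τ.IsCombinatorial) :
    (σ.prod τ).IsCombinatorial where
  finite := by
    have := hσ.finite
    have := hτ.finite
    infer_instance
  t0 := by
    have := hσ.t0
    have := hτ.t0
    infer_instance
  affine x := (hσ.affine x.1).prod (hτ.affine x.2)

theorem IsSCancellativeAt.prod {x : P} {y : Q} (hx : σ.IsSCancellativeAt x)
    (hy : τ.IsSCancellativeAt y) : (σ.prod τ).IsSCancellativeAt (x, y) := by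
  intro p h u v huv
  have huv := congrArg Units.val huv
  refine Units.ext (Prod.ext ?_ ?_)
  · have := @hx _ (specializes_prod.1 h).1 (Units.map (MonoidHom.fst (A x) (B y)) u)
      (Units.map (MonoidHom.fst (A x) (B y)) v) (Units.ext (congrArg Prod.fst huv))
    exact congrArg Units.val this
  · have := @hy _ (specializes_prod.1 h).2 (Units.map (MonoidHom.snd (A x) (B y)) u)
      (Units.map (MonoidHom.snd (A x) (B y)) v) (Units.ext (congrArg Prod.snd huv))
    exact congrArg Units.val this

/-- Compatible families on a product, restricted to a slice and projected to the first factor. -/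
def divFst (hσ : ∀ x, σ.IsAffineAt x) (hτ : ∀ x, τ.IsAffineAt x) (U : Opens (P × Q)) (q : Q) :
    (σ.prod τ).divFamilies U →*
      σ.divFamilies ⟨(fun p => (p, q)) ⁻¹' U, U.2.preimage (by fun_prop)⟩ where
  toFun g := ⟨fun p => SDiv.map (MonoidHom.fst _ _) (g.1 ⟨(p.1, q), p.2⟩), fun p p' h => by
    have h' : (p.1, q) ⤳ (p'.1, q) := specializes_prod.2 ⟨h, specializes_rfl⟩
    beta_reduce
    rw [← g.2 ⟨(p.1, q), p.2⟩ ⟨(p'.1, q), p'.2⟩ h',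
      ← SDiv.map_comp ((hσ _).loc h).preservesSRegular preservesSRegular_fst,
      ← SDiv.map_comp preservesSRegular_fst (((hσ p'.1).prod (hτ q)).loc h').preservesSRegular]
    rfl⟩
  map_one' := Subtype.ext (funext fun y => map_one _)
  map_mul' a b := Subtype.ext (funext fun y => map_mul _ _ _)

/-- Compatible families on a product, restricted to a slice and projected to the second factor. -/
def divSnd (hσ : ∀ x, σ.IsAffineAt x) (hτ : ∀ x, τ.IsAffineAt x) (U : Opens (P × Q)) (p : P) :
    (σ.prod τ).divFamilies U →*
      τ.divFamilies ⟨(fun q => (p, q)) ⁻¹' U, U.2.preimage (by fun_prop)⟩ where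
  toFun g := ⟨fun q => SDiv.map (MonoidHom.snd _ _) (g.1 ⟨(p, q.1), q.2⟩), fun q q' h => by
    have h' : (p, q.1) ⤳ (p, q'.1) := specializes_prod.2 ⟨specializes_rfl, h⟩
    beta_reduce
    rw [← g.2 ⟨(p, q.1), q.2⟩ ⟨(p, q'.1), q'.2⟩ h',
      ← SDiv.map_comp ((hτ _).loc h).preservesSRegular preservesSRegular_snd,
      ← SDiv.map_comp preservesSRegular_snd (((hσ p).prod (hτ q'.1)).loc h').preservesSRegular]
    rfl⟩
  map_one' := Subtype.ext (funext fun y => map_one _)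
  map_mul' a b := Subtype.ext (funext fun y => map_mul _ _ _)

/-- With `ξ` and `η` the generic points of the neighbourhoods of `x` and `y`, the first component is
prolonged along the slice at `η` and the second along the slice at `ξ`. Moving to a generization in
one factor leaves the component in the other factor unchanged, so the slices carry all the
information. -/
theorem SplitAt.prod (hσ : ∀ x, σ.IsAffineAt x) (hτ : ∀ x, τ.IsAffineAt x) {x : P} {y : Q}
    (hx : σ.SplitAt x) (hy : τ.SplitAt y) : (σ.prod τ).SplitAt (x, y) := by
  intro U
  obtain ⟨ξ, hξ, hξ'⟩ := (hσ x).exists_generic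
  obtain ⟨η, hη, hη'⟩ := (hτ y).exists_generic
  obtain ⟨s, hs⟩ := hx ⟨(fun p => (p, η)) ⁻¹' U, U.2.preimage (by fun_prop)⟩
  obtain ⟨t, ht⟩ := hy ⟨(fun q => (ξ, q)) ⁻¹' U, U.2.preimage (by fun_prop)⟩
  refine ⟨((SDiv.map (MonoidHom.inl _ _)).comp (s.comp (divFst hσ hτ U η))) *
    ((SDiv.map (MonoidHom.inr _ _)).comp (t.comp (divSnd hσ hτ U ξ))), ?_⟩
  rintro g ⟨⟨x', y'⟩, hU⟩ h
  have h1 := (specializes_prod.1 h).1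
  have h2 := (specializes_prod.1 h).2
  have hl : IsLoc ((σ.prod τ).map h) := ((hσ x).prod (hτ y)).loc h
  -- Both slice points generize `(x', y')`, hence lie in `U`, and compatibility compares the values
  -- there.
  have hx' : (x', η) ⤳ (x', y') := specializes_prod.2 ⟨specializes_rfl, hη' _ h2⟩
  have hy' : (ξ, y') ⤳ (x', y') := specializes_prod.2 ⟨hξ' _ h1, specializes_rfl⟩
  have hl' := fun p (hp : p ⤳ (x', y')) => (((hσ x').prod (hτ y')).loc hp).preservesSRegular
  have e1 : SDiv.map ((σ.prod τ).map h) (SDiv.map (MonoidHom.inl _ _) (s (divFst hσ hτ U η g))) =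
      SDiv.map (MonoidHom.inl _ _) (SDiv.map (MonoidHom.fst _ _) (g.1 ⟨(x', y'), hU⟩)) := by
    have e : SDiv.map (σ.map h1) (s (divFst hσ hτ U η g)) =
        SDiv.map (MonoidHom.fst _ _) (g.1 ⟨(x', y'), hU⟩) := by
      refine (hs (divFst hσ hτ U η g) ⟨x', hx'.mem_open U.2 hU⟩ h1).trans ?_
      change SDiv.map (MonoidHom.fst _ _) (g.1 ⟨(x', η), _⟩) = _
      rw [← g.2 ⟨(x', η), hx'.mem_open U.2 hU⟩ ⟨(x', y'), hU⟩ hx',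
        ← SDiv.map_comp preservesSRegular_fst (hl' _ _)]
      refine congrFun (congrArg DFunLike.coe (congrArg SDiv.map ?_)) _
      exact MonoidHom.ext fun a => σ.map_refl _ _
    rw [← e, ← SDiv.map_comp hl.preservesSRegular preservesSRegular_inl,
      ← SDiv.map_comp preservesSRegular_inl ((hσ x).loc h1).preservesSRegular]
    refine congrFun (congrArg DFunLike.coe (congrArg SDiv.map ?_)) _
    exact MonoidHom.ext fun a => Prod.ext rfl (map_one (τ.map h2))
  have e2 : SDiv.map ((σ.prod τ).map h) (SDiv.map (MonoidHom.inr _ _) (t (divSnd hσ hτ U ξ g))) =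
      SDiv.map (MonoidHom.inr _ _) (SDiv.map (MonoidHom.snd _ _) (g.1 ⟨(x', y'), hU⟩)) := by
    have e : SDiv.map (τ.map h2) (t (divSnd hσ hτ U ξ g)) =
        SDiv.map (MonoidHom.snd _ _) (g.1 ⟨(x', y'), hU⟩) := by
      refine (ht (divSnd hσ hτ U ξ g) ⟨y', hy'.mem_open U.2 hU⟩ h2).trans ?_
      change SDiv.map (MonoidHom.snd _ _) (g.1 ⟨(ξ, y'), _⟩) = _
      rw [← g.2 ⟨(ξ, y'), hy'.mem_open U.2 hU⟩ ⟨(x', y'), hU⟩ hy',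
        ← SDiv.map_comp preservesSRegular_snd (hl' _ _)]
      refine congrFun (congrArg DFunLike.coe (congrArg SDiv.map ?_)) _
      exact MonoidHom.ext fun a => τ.map_refl _ _
    rw [← e, ← SDiv.map_comp hl.preservesSRegular preservesSRegular_inr,
      ← SDiv.map_comp preservesSRegular_inr ((hτ y).loc h2).preservesSRegular]
    refine congrFun (congrArg DFunLike.coe (congrArg SDiv.map ?_)) _
    exact MonoidHom.ext fun a => Prod.ext (map_one (σ.map h1)) rfl
  rw [MonoidHom.mul_apply, map_mul]
  exact (congrArg₂ (· * ·) e1 e2).trans (SDiv.inl_fst_mul_inr_snd _)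

end Prod

/-! ### Free systems -/

section Free

variable {P : Type u} [TopologicalSpace P] {A : P → Type u} [∀ p, CommMonoid (A p)]
  {σ : Specialization A}

/-- Coordinates on a monoid that is free up to units. -/
structure FreeCoord (M : Type u) [CommMonoid M] (r : ℕ) where
  w : Fin r → M →* Multiplicative ℕ
  atom : Fin r → M
  eq : ∀ m, ∃ u, IsUnit u ∧ m = u * ∏ i, atom i ^ (w i m).toAdd
  atom_ne : ∀ i j, i ≠ j → w i (atom j) = 1
  cancel : ∀ a b c : M, a * b = a * c → b = c

/-- The coordinates on a product of copies of `ℕ` and `ℤ`. -/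
def freeCoord {M : Type u} [CommMonoid M] {r s : ℕ}
    (e : M ≃* (Fin r → Multiplicative ℕ) × (Fin s → Multiplicative ℤ)) : FreeCoord M r where
  w i := ((Pi.evalMonoidHom _ i).comp (MonoidHom.fst _ _)).comp e.toMonoidHom
  atom i := e.symm (Pi.mulSingle i (Multiplicative.ofAdd 1), 1)
  eq m := by
    refine ⟨e.symm (1, (e m).2), ?_, ?_⟩
    · rw [MulEquiv.isUnit_map, Prod.isUnit_iff]
      exact ⟨isUnit_one, Group.isUnit _⟩
    · apply e.injective
      simp only [map_mul, map_prod, map_pow, MulEquiv.apply_symm_apply]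
      refine Prod.ext ?_ ?_
      · rw [Prod.fst_mul, one_mul, Prod.fst_prod]
        ext i
        rw [Finset.prod_apply, Finset.prod_eq_single i]
        · simp [← ofAdd_nsmul]
        · intro j _ hj
          simp [Pi.mulSingle_eq_of_ne hj.symm]
        · simp
      · simp [Prod.snd_mul, Prod.snd_prod]
  atom_ne i j h := by simp [Pi.mulSingle_eq_of_ne h]
  cancel a b c h := by
    apply e.injective
    have := congrArg e h
    simpa using this

theorem isUnit_mulNat {a : Multiplicative ℕ} (h : IsUnit a) : a = 1 := by
  obtain ⟨b, hb⟩ := h.exists_right_inv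
  have : a.toAdd + b.toAdd = 0 := hb
  exact Multiplicative.toAdd.injective (show a.toAdd = 0 by omega)

/-- A cancellative monoid embeds in its localizations. Writing units of `A y` as fractions over `A
x` reduces the claim to injectivity of the map from `A x`. -/
theorem IsAffineAt.isSCancellativeAt_of_cancel {x y : P} (hx : σ.IsAffineAt x)
    (hc : ∀ a b c : A x, a * b = a * c → b = c) (hy : y ⤳ x) : σ.IsSCancellativeAt y := by
  intro z h u v huv
  have huv : σ.map h u = σ.map h v := congrArg Units.val huv
  obtain ⟨α, β, hβ, e⟩ := (hx.loc hy).frac u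
  obtain ⟨α', β', hβ', e'⟩ := (hx.loc hy).frac v
  have inj : Function.Injective (σ.map (h.trans hy)) := fun a a' haa => by
    obtain ⟨b, -, hb⟩ := (hx.loc (h.trans hy)).eq a a' haa
    exact hc _ _ _ hb
  have key : α * β' = α' * β := by
    apply inj
    rw [← σ.map_map h hy, ← σ.map_map h hy, map_mul (σ.map hy), map_mul (σ.map hy), ← e, ← e']
    simp only [map_mul, huv]
    exact mul_right_comm _ _ _
  refine Units.ext ((hβ.mul hβ').mul_right_cancel ?_)
  have := congrArg (σ.map hy) key
  rw [map_mul, map_mul, ← e, ← e'] at this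
  rw [← mul_assoc, this, mul_assoc, mul_comm (σ.map hy β')]

/-- Divisors on a free monoid are combinations of the classes of the atoms, with coefficients
visible at the points `p i` of codimension one. A family is prolonged by keeping the coefficients at
the `p i` in `U` and taking zero elsewhere. -/
theorem IsAffineAt.splitAt_of_freeCoord {x : P} {r : ℕ} (hx : σ.IsAffineAt x)
    (c : FreeCoord (A x) r) : σ.SplitAt x := by
  classical
  intro U
  have hr : ∀ a, a ∈ sRegular (A x) := fun a m u v h => ⟨0, by
    rw [c.cancel _ _ _ h]⟩
  obtain ⟨cl, hcl⟩ : ∃ cl : A x →* SDiv (A x), ∀ a, cl a = SDiv.cls ⟨a, hr a⟩ :=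
    ⟨SDiv.cls.comp ((MonoidHom.id (A x)).codRestrict _ hr), fun _ => rfl⟩
  let toZ : Multiplicative ℕ →* Multiplicative ℤ :=
    AddMonoidHom.toMultiplicative (Nat.castAddMonoidHom ℤ)
  let w : Fin r → A x →* Multiplicative ℤ := fun i => toZ.comp (c.w i)
  have hw : ∀ i u, IsUnit u → w i u = 1 := fun i u hu => by
    have := isUnit_mulNat (hu.map (c.w i))
    simp [w, this]
  -- the decomposition of a divisor into prime divisors
  have hdec : ∀ k : SDiv (A x), k = ∏ i, zpowersHom _ (cl (c.atom i)) (SDiv.lift (w i) (hw i) k) := by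
    have : MonoidHom.id (SDiv (A x)) =
        ∏ i, (zpowersHom _ (cl (c.atom i))).comp (SDiv.lift (w i) (hw i)) := by
      refine SDiv.hom_ext fun a => ?_
      rw [MonoidHom.id_apply, MonoidHom.finsetProd_apply]
      obtain ⟨u, hu, e⟩ := c.eq a
      have h1 : SDiv.cls a = cl a := (hcl a).symm
      rw [h1]
      conv_lhs => rw [e, map_mul, map_prod]
      rw [hcl u, SDiv.cls_unit hu, one_mul]
      refine Finset.prod_congr rfl fun i _ => ?_
      rw [MonoidHom.comp_apply, ← h1, SDiv.lift_cls, map_pow, zpowersHom_apply]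
      exact (zpow_natCast _ _).symm
    intro k
    have := DFunLike.congr_fun this k
    rwa [MonoidHom.id_apply, MonoidHom.finsetProd_apply] at this
  -- the points of codimension one
  have hface := fun i => hx.face (MonoidHom.mker (c.w i)) fun a b hab => by
    rw [MonoidHom.mem_mker, map_mul] at *
    have : (c.w i a).toAdd + (c.w i b).toAdd = 0 := hab
    exact Multiplicative.toAdd.injective (show (c.w i a).toAdd = 0 by omega)
  choose p hp hpu using hface
  -- The coordinate `w i` has values in a group, so it extends to the stalk at `p i`.
  choose v hv using fun i => (hx.loc (hp i)).exists_lift (w i)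
  -- Units at `p i` are fractions of elements of the face where `w i` is trivial.
  have hvu : ∀ i u, IsUnit u → v i u = 1 := fun i u hu => by
    obtain ⟨a, b, hb, e⟩ := (hx.loc (hp i)).frac u
    have ha : IsUnit (σ.map (hp i) a) := e ▸ hu.mul hb
    have e' := congrArg (v i) e
    have h1 : ∀ a, IsUnit (σ.map (hp i) a) → w i a = 1 := fun a ha => by
      have := (hpu i a).2 ha
      rw [MonoidHom.mem_mker] at this
      simp [w, this]
    rw [map_mul, hv, hv, h1 a ha, h1 b hb, mul_one] at e'
    exact e'
  have hvw : ∀ i k, SDiv.lift (v i) (hvu i) (SDiv.map (σ.map (hp i)) k) =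
      SDiv.lift (w i) (hw i) k := fun i k => by
    have : (SDiv.lift (v i) (hvu i)).comp (SDiv.map (σ.map (hp i))) =
        SDiv.lift (w i) (hw i) := SDiv.hom_ext fun a => by
      rw [MonoidHom.comp_apply, SDiv.map_cls (hx.loc (hp i)).preservesSRegular,
        SDiv.lift_cls, SDiv.lift_cls]
      exact hv i _
    exact DFunLike.congr_fun this k
  -- The coefficient along the `i`-th atom; the value `1` in `Multiplicative ℤ` is the coefficient
  -- zero.
  let n : Fin r → σ.divFamilies U →* Multiplicative ℤ := fun i =>
    if h : p i ∈ U then (SDiv.lift (v i) (hvu i)).comp (σ.divEval U ⟨p i, h⟩) else 1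
  refine ⟨∏ i, (zpowersHom _ (cl (c.atom i))).comp (n i), fun g y hy => ?_⟩
  -- The value at `y` is lifted to a divisor `k` at `x`, and the two sides are compared atom by
  -- atom.
  obtain ⟨k, hk⟩ := SDiv.map_surjective (hx.loc hy) hr (g.1 y)
  rw [← hk]
  conv_rhs => rw [hdec k]
  rw [MonoidHom.finsetProd_apply, map_prod, map_prod]
  refine Finset.prod_congr rfl fun i _ => ?_
  rw [MonoidHom.comp_apply]
  -- If the atom becomes a unit at `y`, its class vanishes there and any coefficient works.
  -- Otherwise `p i` generizes `y`, so it lies in `U` and gives the correct coefficient.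
  by_cases hi : IsUnit (σ.map hy (c.atom i))
  · have : SDiv.map (σ.map hy) (cl (c.atom i)) = 1 := by
      rw [hcl, SDiv.map_cls (hx.loc hy).preservesSRegular]
      exact SDiv.cls_unit hi _
    rw [zpowersHom_apply, zpowersHom_apply, map_zpow, map_zpow, this, one_zpow, one_zpow]
  · have hpy : p i ⤳ y := hx.specializes (hp i) hy fun m hm => by
      rw [← hpu, MonoidHom.mem_mker]
      -- If `w i m` were nontrivial, the `i`-th atom would divide `m` up to a unit and so be a unit
      -- at `y`.
      by_contra hne
      obtain ⟨u, -, e⟩ := c.eq m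
      rw [e, map_mul, map_prod] at hm
      have := isUnit_of_dvd_unit (Finset.dvd_prod_of_mem _ (Finset.mem_univ i))
        (isUnit_of_mul_isUnit_right hm)
      rw [map_pow] at this
      refine hi ((isUnit_pow_iff ?_).1 this)
      exact fun h0 => hne (Multiplicative.toAdd.injective h0)
    have hpU : p i ∈ U := hpy.mem_open U.2 y.2
    have : n i g = SDiv.lift (w i) (hw i) k := by
      simp only [n, dif_pos hpU]
      rw [MonoidHom.comp_apply, ← hvw]
      congr 1
      refine (g.2 ⟨p i, hpU⟩ y hpy).symm.trans ?_
      rw [← hk, divMap_map hpy hy (hx.loc_of_specializes hy hpy) (hx.loc hy)]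
    rw [this]

end Free

end Specialization

/-! ### The stalk system of a space with a sheaf of monoids -/

/-- The stalks and their specialization maps. -/
def stalkSys (X : SheafedSpace CommMonCat.{u}) :
    Specialization (fun x : X => (X.presheaf.stalk x : Type u)) where
  map h := (X.presheaf.stalkSpecializes h).hom
  map_refl {x} h a := by
    have := X.presheaf.stalkSpecializes_refl x
    exact ConcreteCategory.congr_hom this a
  map_map {z y x} h h' a :=
    ConcreteCategory.congr_hom (X.presheaf.stalkSpecializes_comp h h') a

theorem stalkSys_map_germ (X : SheafedSpace CommMonCat.{u}) {y x : X} (h : y ⤳ x) (U : Opens X)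
    (hx : x ∈ U) (s : X.presheaf.obj (op U)) :
    (stalkSys X).map h (X.presheaf.germ U x hx s) =
      X.presheaf.germ U y (h.mem_open U.2 hx) s :=
  ConcreteCategory.congr_hom (X.presheaf.germ_stalkSpecializes hx h) s

/-- The isomorphism of stalk systems induced by an open immersion. -/
def localIsoOfOpenImmersion {X Y : SheafedSpace CommMonCat.{u}} (f : X ⟶ Y)
    [SheafedSpace.IsOpenImmersion f] : (stalkSys X).LocalIso (stalkSys Y) where
  toFun := f.hom.base
  isOpenEmbedding := PresheafedSpace.IsOpenImmersion.base_open (f := f.hom)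
  equiv x := (asIso (f.hom.stalkMap x)).commMonCatIsoToMulEquiv
  equiv_map h b :=
    ConcreteCategory.congr_hom (PresheafedSpace.stalkMap.stalkSpecializes_stalkMap f.hom h) b

theorem IsSpecOn.exists_openImmersion {X : SheafedSpace CommMonCat.{u}} {U : Opens X}
    {M : CommMonCat.{u}} (h : IsSpecOn X U M) :
    ∃ f : Spec M ⟶ X, SheafedSpace.IsOpenImmersion f ∧ Set.range f.hom.base = U := by
  obtain ⟨e⟩ := h
  refine ⟨e.inv ≫ X.ofRestrict U.isOpenEmbedding, inferInstance, ?_⟩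
  have he : Function.Surjective e.inv.hom.base := by
    have : IsIso e.inv.hom.base := inferInstanceAs (IsIso ((SheafedSpace.forget _).map e.inv))
    exact ((TopCat.isIso_iff_isHomeomorph _).1 this).surjective
  rw [SheafedSpace.comp_hom_base, TopCat.coe_comp, he.range_comp]
  exact Subtype.range_coe

/-! ### Stalks of spectra -/

/-- The images of the generators, with the inverses of those that become units, suffice: a product
is a unit only if its factors are. -/
theorem IsLoc.fg {M N : Type u} [CommMonoid M] [CommMonoid N] {f : M →* N} (hf : IsLoc f)
    (hM : Monoid.FG M) : Monoid.FG N := by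
  classical
  obtain ⟨S, hS⟩ := hM.fg_top
  let T : Set N := f '' S ∪ {n | ∃ s ∈ S, f s * n = 1}
  have hT : T.Finite := by
    refine (S.finite_toSet.image f).union ?_
    refine (S.finite_toSet.image fun s => if h : ∃ n, f s * n = 1 then h.choose else 1).subset ?_
    rintro n ⟨s, hs, h⟩
    have hex : ∃ n, f s * n = 1 := ⟨n, h⟩
    refine ⟨s, hs, ?_⟩
    simp only [dif_pos hex]
    refine (IsUnit.of_mul_eq_one _ h).mul_left_cancel (hex.choose_spec.trans h.symm)
  have h1 : ∀ m, f m ∈ Submonoid.closure T := by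
    intro m
    have hm : m ∈ Submonoid.closure (S : Set M) := by rw [hS]; trivial
    have := Submonoid.mem_map_of_mem f hm
    rw [MonoidHom.map_mclosure] at this
    exact Submonoid.closure_mono Set.subset_union_left this
  have h2 : ∀ m, IsUnit (f m) → ∃ n ∈ Submonoid.closure T, f m * n = 1 := by
    intro m
    have hm : m ∈ Submonoid.closure (S : Set M) := by rw [hS]; trivial
    induction hm using Submonoid.closure_induction with
    | mem s hs =>
      intro h
      obtain ⟨n, hn⟩ := h.exists_right_inv
      exact ⟨n, Submonoid.subset_closure (Or.inr ⟨s, hs, hn⟩), hn⟩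
    | one => exact fun _ => ⟨1, one_mem _, by simp⟩
    | mul a b _ _ ha hb =>
      intro h
      rw [map_mul] at h
      obtain ⟨n, hn, e⟩ := ha (isUnit_of_mul_isUnit_left h)
      obtain ⟨n', hn', e'⟩ := hb (isUnit_of_mul_isUnit_right h)
      exact ⟨n * n', mul_mem hn hn', by rw [map_mul, mul_mul_mul_comm, e, e', one_mul]⟩
  refine ⟨⟨hT.toFinset, ?_⟩⟩
  rw [Set.Finite.coe_toFinset, eq_top_iff]
  intro n _
  obtain ⟨a, b, hb, e⟩ := hf.frac n
  obtain ⟨c, hc, ec⟩ := h2 b hb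
  have : n = f a * c := by rw [← e, mul_assoc, ec, mul_one]
  rw [this]
  exact mul_mem (h1 a) hc

namespace PrimeSpec

variable {M : Type u} [CommMonoid M]

theorem isOpen_basicOpen (f : M) : IsOpen (basicOpen f) :=
  TopologicalSpace.isOpen_generateFrom_of_mem ⟨f, rfl⟩

theorem specializes_iff {q p : PrimeSpec M} :
    q ⤳ p ↔ ∀ m, m ∉ p.asIdeal → m ∉ q.asIdeal := by
  constructor
  · intro h m hm
    exact h.mem_open (isOpen_basicOpen m) hm
  · intro h
    rw [Specializes, TopologicalSpace.nhds_generateFrom (a := p)]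
    refine le_iInf₂ fun s hs => ?_
    obtain ⟨hp, m, rfl⟩ := hs
    exact Filter.le_principal_iff.2 ((isOpen_basicOpen m).mem_nhds (h m hp))

/-- The prime ideal complementary to a face. -/
def ofFace (F : Submonoid M) (hF : ∀ a b, a * b ∈ F → a ∈ F) : PrimeSpec M where
  asIdeal :=
    { carrier := (F : Set M)ᶜ
      smul_mem' := fun c x hx h => hx (hF x c (by rwa [mul_comm])) }
  one_notMem h := h F.one_mem
  mem_or_mem {a b} h := by
    by_contra hab
    rw [not_or] at hab
    exact h (mul_mem (not_not.1 hab.1) (not_not.1 hab.2))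

theorem notMem_ofFace {F : Submonoid M} {hF : ∀ a b, a * b ∈ F → a ∈ F} {a : M} :
    a ∉ (ofFace F hF).asIdeal ↔ a ∈ F := not_not

theorem mul_notMem {p : PrimeSpec M} {a b : M} (h : a * b ∉ p.asIdeal) : a ∉ p.asIdeal := by
  intro ha
  refine h ?_
  rw [mul_comm]
  exact p.asIdeal.smul_mem b ha

instance : T0Space (PrimeSpec M) where
  t0 p q h := by
    have h1 := specializes_iff.1 h.specializes
    have h2 := specializes_iff.1 h.specializes'
    ext m
    exact not_iff_not.1 ⟨h2 m, h1 m⟩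

/-- A prime is determined by the generators it contains, because its complement is a submonoid
closed under divisors. -/
theorem finite_of_fg (h : Monoid.FG M) : Finite (PrimeSpec M) := by
  obtain ⟨S, hS⟩ := h.fg_top
  refine Finite.of_injective (β := Set S) (fun p => {s : S | (s : M) ∉ p.asIdeal}) fun p q hpq => ?_
  have key : ∀ p q : PrimeSpec M, {s : S | (s : M) ∉ p.asIdeal} = {s : S | (s : M) ∉ q.asIdeal} →
      ∀ m, m ∉ p.asIdeal → m ∉ q.asIdeal := by
    intro p q h m
    have hm : m ∈ Submonoid.closure (S : Set M) := by rw [hS]; trivial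
    induction hm using Submonoid.closure_induction with
    | mem s hs => exact fun h' => (Set.ext_iff.1 h ⟨s, hs⟩).1 h'
    | one => exact fun _ => q.one_notMem
    | mul a b _ _ ha hb =>
      intro hab hab'
      rcases q.mem_or_mem hab' with h | h
      · exact ha (mul_notMem hab) h
      · rw [mul_comm] at hab
        exact hb (mul_notMem hab) h
  ext m
  exact not_iff_not.1 ⟨key p q hpq m, key q p hpq.symm m⟩

end PrimeSpec

namespace Spec

variable (M : CommMonCat.{u})

/-- The section `a / b` over `D(b)`. -/
def fracSection (a b : M) : (Spec M).presheaf.obj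
    (op (⟨PrimeSpec.basicOpen b, PrimeSpec.isOpen_basicOpen b⟩ : Opens (PrimeSpec.Top M))) :=
  ⟨fun x => Localization.mk a ⟨b, x.2⟩, fun x => ⟨_, x.2, 𝟙 _, a, b, fun y => ⟨y.2, rfl⟩⟩⟩

/-- Elements of `M` as global sections. -/
def toGlobal : M →* (Spec M).presheaf.obj (op ⊤) where
  toFun a := ⟨fun x => Localization.mk a 1, fun x =>
    ⟨_, x.2, 𝟙 _, a, 1, fun y => ⟨(PrimeSpec.primeCompl y.1).one_mem, rfl⟩⟩⟩
  map_one' := Subtype.ext (funext fun x => Localization.mk_one)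
  map_mul' a b := Subtype.ext (funext fun x => by
    refine Eq.trans ?_ (Localization.mk_mul _ _ _ _).symm
    rw [one_mul])

/-- The map from `M` to the stalk at a prime ideal. -/
def toStalk (p : Spec M) : M →* (Spec M).presheaf.stalk p :=
  ((Spec M).presheaf.germ ⊤ p trivial).hom.comp (toGlobal M)

variable {M}

theorem map_toStalk {q p : Spec M} (h : q ⤳ p) (m : M) :
    (stalkSys (Spec M)).map h (toStalk M p m) = toStalk M q m :=
  stalkSys_map_germ _ h ⊤ trivial _

theorem toStalk_eq_germ (p : Spec M) (U : Opens (PrimeSpec.Top M)) (hU : p ∈ U) (a : M) :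
    toStalk M p a = (Spec M).presheaf.germ U p hU
      ((Spec M).presheaf.map (homOfLE (le_top : U ≤ ⊤)).op (toGlobal M a)) :=
  ((Spec M).presheaf.germ_res_apply _ _ _ _).symm

theorem germ_frac_mul_toStalk (p : Spec M) (a b : M) (hb : b ∉ PrimeSpec.asIdeal p) :
    (Spec M).presheaf.germ (⟨PrimeSpec.basicOpen b, PrimeSpec.isOpen_basicOpen b⟩ :
      Opens (PrimeSpec.Top M)) p hb (fracSection M a b) * toStalk M p b = toStalk M p a := by
  rw [toStalk_eq_germ p ⟨PrimeSpec.basicOpen b, PrimeSpec.isOpen_basicOpen b⟩ hb,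
    toStalk_eq_germ p ⟨PrimeSpec.basicOpen b, PrimeSpec.isOpen_basicOpen b⟩ hb]
  refine (map_mul ((Spec M).presheaf.germ _ p hb).hom _ _).symm.trans ?_
  congr 1
  refine Subtype.ext (funext fun x => ?_)
  change Localization.mk a ⟨b, x.2⟩ * Localization.mk b 1 = Localization.mk a 1
  rw [Localization.mk_mul, Localization.mk_eq_mk_iff, Localization.r_iff_exists]
  exact ⟨1, by simp [mul_comm]⟩

theorem exists_mul_toStalk (p : Spec M) (t : (Spec M).presheaf.stalk p) :
    ∃ a b : M, b ∉ PrimeSpec.asIdeal p ∧ t * toStalk M p b = toStalk M p a := by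
  obtain ⟨U, hU, s, rfl⟩ := (Spec M).presheaf.exists_germ_eq t
  obtain ⟨V, hV, i, a, b, h⟩ := s.2 ⟨p, hU⟩
  obtain ⟨hb, -⟩ := h ⟨p, hV⟩
  refine ⟨a, b, hb, ?_⟩
  rw [← germ_frac_mul_toStalk p a b hb]
  congr 1
  let D : Opens (PrimeSpec.Top M) := ⟨PrimeSpec.basicOpen b, PrimeSpec.isOpen_basicOpen b⟩
  let j : V ⟶ D := homOfLE fun x hx => (h ⟨x, hx⟩).1
  refine ((Spec M).presheaf.germ_res_apply i p hV s).symm.trans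
    (Eq.trans ?_ ((Spec M).presheaf.germ_res_apply j p hV (fracSection M a b)))
  congr 1
  exact Subtype.ext (funext fun x => (h x).2)

theorem exists_of_toStalk_eq {p : Spec M} {a a' : M} (h : toStalk M p a = toStalk M p a') :
    ∃ c : M, c ∉ PrimeSpec.asIdeal p ∧ c * a = c * a' := by
  obtain ⟨W, hW, i, i', e⟩ := (Spec M).presheaf.germ_eq (U := ⊤) (V := ⊤) p trivial trivial _ _ h
  have := congrFun (congrArg Subtype.val e) ⟨p, hW⟩
  change Localization.mk a 1 = Localization.mk a' 1 at this
  rw [Localization.mk_eq_mk_iff, Localization.r_iff_exists] at this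
  obtain ⟨c, hc⟩ := this
  exact ⟨c, c.2, by simpa using hc⟩

theorem isUnit_toStalk {p : Spec M} {m : M} :
    IsUnit (toStalk M p m) ↔ m ∉ PrimeSpec.asIdeal p := by
  constructor
  · intro h
    obtain ⟨t, ht⟩ := h.exists_right_inv
    obtain ⟨a, b, hb, e⟩ := exists_mul_toStalk p t
    have : toStalk M p b = toStalk M p (m * a) := by
      rw [map_mul, ← e, ← mul_assoc, ht, one_mul]
    obtain ⟨c, hc, h⟩ := exists_of_toStalk_eq this
    have h1 : c * b ∉ PrimeSpec.asIdeal p := fun h => (PrimeSpec.mem_or_mem p h).elim hc hb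
    rw [h, mul_left_comm] at h1
    exact PrimeSpec.mul_notMem h1
  · intro h
    have := germ_frac_mul_toStalk p 1 m h
    rw [map_one] at this
    exact IsUnit.of_mul_eq_one_right _ this

theorem isLoc_toStalk (p : Spec M) : IsLoc (toStalk M p) where
  frac n := by
    obtain ⟨a, b, hb, e⟩ := exists_mul_toStalk p n
    exact ⟨a, b, isUnit_toStalk.2 hb, e⟩
  eq a a' h := by
    obtain ⟨c, hc, e⟩ := exists_of_toStalk_eq h
    exact ⟨c, isUnit_toStalk.2 hc, e⟩

/-- Stalks are localizations of `M`. A face of the stalk at `p` pulls back to a face of `M`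
containing the complement of `p`, that is, to a prime contained in `p`. -/
theorem isCombinatorial (hM : Monoid.FG M) : (stalkSys (Spec M)).IsCombinatorial where
  finite := PrimeSpec.finite_of_fg hM
  t0 := inferInstanceAs (T0Space (PrimeSpec M))
  affine p :=
    { fg := (isLoc_toStalk p).fg hM
      loc := fun {q} h => IsLoc.of_comp (isLoc_toStalk p) (by
        have : ((stalkSys (Spec M)).map h).comp (toStalk M p) = toStalk M q :=
          MonoidHom.ext fun m => map_toStalk h m
        rw [this]
        exact isLoc_toStalk q)
      specializes := fun {q r} hq hr H => by
        refine PrimeSpec.specializes_iff.2 fun m hm => ?_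
        have := H (toStalk M p m)
        rw [map_toStalk, map_toStalk, isUnit_toStalk, isUnit_toStalk] at this
        exact this hm
      face := fun F hF => by
        have hu : ∀ n, IsUnit n → n ∈ F := fun n hn => by
          obtain ⟨n', h⟩ := hn.exists_right_inv
          exact hF n n' (h ▸ F.one_mem)
        let q : Spec M := PrimeSpec.ofFace (F.comap (toStalk M p)) fun a b h =>
          hF (toStalk M p a) (toStalk M p b) (by simpa using h)
        have hq : ∀ m, m ∉ PrimeSpec.asIdeal q ↔ toStalk M p m ∈ F := fun m => PrimeSpec.notMem_ofFace
        have hqp : q ⤳ p := PrimeSpec.specializes_iff.2 fun m hm =>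
          (hq m).2 (hu _ (isUnit_toStalk.2 hm))
        refine ⟨q, hqp, fun n => ?_⟩
        obtain ⟨a, b, hb, e⟩ := (isLoc_toStalk p).frac n
        have h1 : n ∈ F ↔ toStalk M p a ∈ F := by
          rw [← e]
          exact ⟨fun h => mul_mem h (hu _ hb), fun h => hF _ _ h⟩
        have h2 := congrArg ((stalkSys (Spec M)).map hqp) e
        rw [map_mul, map_toStalk, map_toStalk] at h2
        have hb' : IsUnit (toStalk M q b) := by
          rw [← map_toStalk hqp]
          exact hb.map _
        rw [h1, ← hq, ← isUnit_toStalk (p := q), ← h2]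
        exact ⟨isUnit_of_mul_isUnit_left, fun h => h.mul hb'⟩ }

end Spec

/-! ### Monoid schemes of finite type and their sheaves of `s`-divisors -/

theorem IsFiniteType.isCombinatorial {X : SheafedSpace CommMonCat.{u}} (h : IsFiniteType X) :
    (stalkSys X).IsCombinatorial := by
  obtain ⟨n, U, M, hU, hM⟩ := h
  choose f hf hfU using fun i => (hM i).2.exists_openImmersion
  let j := fun i => localIsoOfOpenImmersion (f i)
  have hj : ∀ i, Set.range (j i).toFun = U i := hfU
  have hcov : ∀ x : X, ∃ i p, (j i).toFun p = x := fun x => by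
    have hx : x ∈ ⨆ i, U i := hU ▸ trivial
    obtain ⟨i, hi⟩ := Opens.mem_iSup.1 hx
    have : x ∈ Set.range (j i).toFun := hj i ▸ hi
    exact ⟨i, this⟩
  exact Specialization.IsCombinatorial.of_cover j hcov fun i => Spec.isCombinatorial (hM i).1

/-! ### Smallest neighbourhoods in finite spaces -/

section MinOpen

variable {X : SheafedSpace CommMonCat.{u}}

/-- The smallest open neighbourhood of a point of a finite space. -/
def minOpen [Finite X] (x : X) : Opens X :=
  ⟨{y | y ⤳ x}, isOpen_iff_forall_specializes.2 fun _ _ h h' => h.trans h'⟩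

theorem mem_minOpen [Finite X] (x : X) : x ∈ minOpen x := specializes_rfl

theorem minOpen_le [Finite X] {x : X} {U : Opens X} (h : x ∈ U) : minOpen x ≤ U :=
  fun _ hy => Specializes.mem_open hy U.2 h

theorem exists_germ_minOpen [Finite X] (x : X) (t : X.presheaf.stalk x) :
    ∃ s, X.presheaf.germ (minOpen x) x (mem_minOpen x) s = t := by
  obtain ⟨U, hU, s, rfl⟩ := X.presheaf.exists_germ_eq t
  exact ⟨X.presheaf.map (homOfLE (minOpen_le hU)).op s,
    X.presheaf.germ_res_apply (homOfLE (minOpen_le hU)) x (mem_minOpen x) s⟩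

end MinOpen

/-! ### The sheaf of `s`-divisors as compatible families -/

section Divisors

variable {X : SheafedSpace CommMonCat.{u}}

theorem fraction_of_sMer {U : Opens X} (σ : (sMer X).sections U) (x : X) (hx : x ∈ U) :
    ∃ (V : Opens X) (_ : x ∈ V) (_ : V ≤ U) (a b : X.presheaf.obj (op V)), ∀ (y : X) (hy : y ∈ V)
      (hyU : y ∈ U), ∃ hb : X.presheaf.germ V y hy b ∈ sRegular (X.presheaf.stalk y),
        σ.1 ⟨y, hyU⟩ = Localization.mk (X.presheaf.germ V y hy a) ⟨X.presheaf.germ V y hy b, hb⟩ := by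
  obtain ⟨V, hV, i, a, b, h⟩ := σ.2 ⟨x, hx⟩
  exact ⟨V, hV, i.le, a, b, fun y hy hyU => h ⟨y, hy⟩⟩

/-- The unit of the semi-meromorphic sections given by a fraction of `s`-regular sections. -/
def fracUnit (U : Opens X) (a b : X.presheaf.obj (op U))
    (ha : ∀ x hx, X.presheaf.germ U x hx a ∈ sRegular (X.presheaf.stalk x))
    (hb : ∀ x hx, X.presheaf.germ U x hx b ∈ sRegular (X.presheaf.stalk x)) :
    ((sMer X).sections U)ˣ where
  val := ⟨fun x => Localization.mk (X.presheaf.germ U x.1 x.2 a)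
    ⟨X.presheaf.germ U x.1 x.2 b, hb _ _⟩, fun x => ⟨U, x.2, 𝟙 _, a, b, fun y => ⟨hb _ _, rfl⟩⟩⟩
  inv := ⟨fun x => Localization.mk (X.presheaf.germ U x.1 x.2 b)
    ⟨X.presheaf.germ U x.1 x.2 a, ha _ _⟩, fun x => ⟨U, x.2, 𝟙 _, b, a, fun y => ⟨ha _ _, rfl⟩⟩⟩
  val_inv := Subtype.ext (funext fun x => by
    refine (Localization.mk_mul _ _ _ _).trans ?_
    rw [mul_comm]
    exact Localization.mk_self (⟨_, mul_mem (hb _ _) (ha _ _)⟩ : sRegular (X.presheaf.stalk x.1)))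
  inv_val := Subtype.ext (funext fun x => by
    refine (Localization.mk_mul _ _ _ _).trans ?_
    rw [mul_comm]
    exact Localization.mk_self (⟨_, mul_mem (ha _ _) (hb _ _)⟩ : sRegular (X.presheaf.stalk x.1)))

/-- A local fraction `a / b` of sections has germs that correspond under specialization, which gives
compatibility. Conversely, the value at `x` is a fraction of germs, which extend to the smallest
neighbourhood of `x`; compatibility forces the fraction to represent the family there. -/
theorem sDiv_pred_iff (hX : (stalkSys X).IsCombinatorial) (U : Opens X)
    (g : ∀ x : U, SDiv (X.presheaf.stalk x.1 : Type u)) :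
    (sDiv X).pred (U := U) g ↔ g ∈ (stalkSys X).divFamilies U := by
  have := hX.finite
  have hl : ∀ {y x : X} (h : y ⤳ x), PreservesSRegular ((stalkSys X).map h) :=
    fun h => ((hX.affine _).loc h).preservesSRegular
  constructor
  · intro hg y z h
    obtain ⟨V, hzV, i, σ, hσ⟩ := hg z
    have hyV : y.1 ∈ V := h.mem_open V.2 hzV
    obtain ⟨W, hzW, hWV, a, b, hab⟩ := fraction_of_sMer σ.1 z.1 hzV
    have hyW : y.1 ∈ W := h.mem_open W.2 hzW
    obtain ⟨hbz, ez⟩ := hab z.1 hzW hzV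
    obtain ⟨hby, ey⟩ := hab y.1 hyW hyV
    obtain ⟨haz, ez'⟩ := SDiv.mk_eq_div (unitValue X σ ⟨z.1, hzV⟩) _ _ ez
    obtain ⟨hay, ey'⟩ := SDiv.mk_eq_div (unitValue X σ ⟨y.1, hyV⟩) _ _ ey
    have e1 : g z = _ := (hσ ⟨z.1, hzV⟩).trans ez'
    have e2 : g y = _ := (hσ ⟨y.1, hyV⟩).trans ey'
    rw [e1, e2, map_div, SDiv.map_cls (hl h), SDiv.map_cls (hl h)]
    congr 2
    · exact Subtype.ext (stalkSys_map_germ X h W hzW a)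
    · exact Subtype.ext (stalkSys_map_germ X h W hzW b)
  · intro hg x
    obtain ⟨⟨a, ha⟩, ⟨b, hb⟩, e⟩ := SDiv.exists_eq_div (g x)
    obtain ⟨a, rfl⟩ := exists_germ_minOpen x.1 a
    obtain ⟨b, rfl⟩ := exists_germ_minOpen x.1 b
    -- `s`-regularity at `x` spreads to all generizations, because localizations preserve it.
    have hh : ∀ c, X.presheaf.germ _ x.1 (mem_minOpen x.1) c ∈ sRegular (X.presheaf.stalk x.1) →
        ∀ y hy, X.presheaf.germ (minOpen x.1) y hy c ∈ sRegular (X.presheaf.stalk y) :=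
      fun c hc y hy => by
        have := hl (show y ⤳ x.1 from hy) _ hc
        rwa [stalkSys_map_germ] at this
    refine ⟨minOpen x.1, mem_minOpen _, homOfLE (minOpen_le x.2),
      fracUnit _ a b (hh a ha) (hh b hb), fun y => ?_⟩
    have hy : y.1 ⤳ x.1 := y.2
    obtain ⟨h1, h2⟩ := SDiv.mk_eq_div (unitValue X (fracUnit _ a b (hh a ha) (hh b hb)) y)
      (X.presheaf.germ _ y.1 y.2 a) ⟨X.presheaf.germ _ y.1 y.2 b, hh b hb _ _⟩ rfl
    refine Eq.trans ?_ h2.symm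
    have := hg ⟨y.1, minOpen_le x.2 y.2⟩ x hy
    refine this.symm.trans ?_
    rw [e, map_div, SDiv.map_cls (hl hy), SDiv.map_cls (hl hy)]
    congr 2
    · exact Subtype.ext (stalkSys_map_germ X hy _ _ a)
    · exact Subtype.ext (stalkSys_map_germ X hy _ _ b)

/-- Sections of the sheaf of `s`-divisors are compatible families. -/
def sDivEquiv (hX : (stalkSys X).IsCombinatorial) (U : Opens X) :
    (sDiv X).presheaf.obj (op U) ≃* (stalkSys X).divFamilies U where
  toFun g := ⟨g.1, (sDiv_pred_iff hX U _).1 g.2⟩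
  invFun g := ⟨g.1, (sDiv_pred_iff hX U _).2 g.2⟩
  map_mul' _ _ := rfl

theorem isSFlasque_iff (hX : (stalkSys X).IsCombinatorial) :
    IsSFlasque (sDiv X).presheaf ↔ ∀ x, (stalkSys X).SplitAt x := by
  have := hX.finite
  have := hX.t0
  constructor
  · intro h x
    refine Specialization.splitAt_of_section (fun U => ?_) x
    obtain ⟨⟨s, hs⟩⟩ := (h U).exists_splitEpi
    refine ⟨((sDivEquiv hX ⊤).toMonoidHom.comp s.hom).comp (sDivEquiv hX U).symm.toMonoidHom,
      fun g => ?_⟩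
    have := ConcreteCategory.congr_hom hs ((sDivEquiv hX U).symm g)
    have h2 := congrArg Subtype.val this
    exact Subtype.ext h2
  · intro h U
    obtain ⟨s, hs⟩ := Specialization.exists_section h U
    refine ⟨⟨⟨CommGrpCat.ofHom
      (((sDivEquiv hX ⊤).symm.toMonoidHom.comp s).comp (sDivEquiv hX U).toMonoidHom), ?_⟩⟩⟩
    ext g
    have h2 := congrArg Subtype.val (hs (sDivEquiv hX U g))
    exact Subtype.ext h2

/-- Beyond finite type, `s`-smoothness is a condition on each point separately; locality, products
and the smooth case all rest on this. -/
theorem isSSmooth_iff : IsSSmooth X ↔ IsFiniteType X ∧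
    ∀ x, (stalkSys X).IsSCancellativeAt x ∧ (stalkSys X).SplitAt x := by
  refine and_congr_right fun h => ?_
  rw [isSFlasque_iff h.isCombinatorial, forall_and]
  refine and_congr_left fun _ => ⟨fun h x y hy => h hy, fun h x y hy => h y hy⟩

end Divisors

/-! ### Morphisms from maps of stalks -/

section HomOfStalks

theorem germ_ext {X : SheafedSpace CommMonCat.{u}} {U : Opens X} {s t : X.presheaf.obj (op U)}
    (h : ∀ x hx, X.presheaf.germ U x hx s = X.presheaf.germ U x hx t) : s = t :=
  TopCat.Presheaf.section_ext X.sheaf U s t h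

/-- Sections are determined by their germs, so local sections with the prescribed germs agree on
overlaps and glue. -/
theorem exists_section_of_germs {X : SheafedSpace CommMonCat.{u}} (V : Opens X)
    (g : ∀ x, x ∈ V → X.presheaf.stalk x)
    (hg : ∀ x ∈ V, ∃ (U : Opens X) (_ : x ∈ U) (t : X.presheaf.obj (op U)),
      ∀ y (hy : y ∈ U) (hy' : y ∈ V), X.presheaf.germ U y hy t = g y hy') :
    ∃ t : X.presheaf.obj (op V), ∀ x hx, X.presheaf.germ V x hx t = g x hx := by
  choose U hU t ht using fun x : V => hg x.1 x.2
  let W : V → Opens X := fun x => U x ⊓ V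
  let sf : ∀ x, X.presheaf.obj (op (W x)) := fun x => X.presheaf.map (homOfLE inf_le_left).op (t x)
  have hsf : ∀ x y (hy : y ∈ W x), X.presheaf.germ (W x) y hy (sf x) = g y hy.2 := fun x y hy =>
    (X.presheaf.germ_res_apply (homOfLE inf_le_left : W x ⟶ U x) y hy (t x)).trans (ht x y hy.1 hy.2)
  obtain ⟨s, hs, -⟩ := X.sheaf.existsUnique_gluing' W V (fun x => homOfLE inf_le_right)
    (fun x hx => Opens.mem_iSup.2 ⟨⟨x, hx⟩, hU ⟨x, hx⟩, hx⟩) sf (by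
      intro x x'
      refine germ_ext fun y hy => ?_
      have h1 := X.presheaf.germ_res_apply (Opens.infLELeft (W x) (W x')) y hy (sf x)
      have h2 := X.presheaf.germ_res_apply (Opens.infLERight (W x) (W x')) y hy (sf x')
      exact h1.trans ((hsf x y hy.1).trans ((hsf x' y hy.2).symm.trans h2.symm)))
  refine ⟨s, fun x hx => ?_⟩
  have hxW : x ∈ W ⟨x, hx⟩ := ⟨hU ⟨x, hx⟩, hx⟩
  have h1 := X.presheaf.germ_res_apply (homOfLE inf_le_right : W ⟨x, hx⟩ ⟶ V) x hxW s
  refine h1.symm.trans (Eq.trans ?_ (hsf ⟨x, hx⟩ x hxW))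
  exact congrArg _ (hs ⟨x, hx⟩)

variable {X Y : SheafedSpace CommMonCat.{u}} (f : C(X, Y))
  (φ : ∀ x : X, Y.presheaf.stalk (f x) →* X.presheaf.stalk x)
  (hφ : ∀ (V : Opens Y) (s : Y.presheaf.obj (op V)) (x : X) (_ : f x ∈ V),
    ∃ (U : Opens X) (_ : x ∈ U) (t : X.presheaf.obj (op U)), ∀ y (hy : y ∈ U) (hy' : f y ∈ V),
      X.presheaf.germ U y hy t = φ y (Y.presheaf.germ V (f y) hy' s))

include hφ in
theorem exists_pullback (V : Opens Y) (s : Y.presheaf.obj (op V)) :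
    ∃ t : X.presheaf.obj (op ((Opens.map (TopCat.ofHom f)).obj V)), ∀ x (hx : f x ∈ V),
      X.presheaf.germ ((Opens.map (TopCat.ofHom f)).obj V) x hx t =
        φ x (Y.presheaf.germ V (f x) hx s) :=
  exists_section_of_germs ((Opens.map (TopCat.ofHom f)).obj V)
    (fun x hx => φ x (Y.presheaf.germ V (f x) hx s)) (fun x hx => hφ V s x hx)

/-- The morphism with given map of spaces and given maps of stalks. -/
def homOfStalks : X ⟶ Y := InducedCategory.homMk
  { base := TopCat.ofHom f
    c :=
      { app := fun V => CommMonCat.ofHom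
          { toFun := fun s => (exists_pullback f φ hφ V.unop s).choose
            map_one' := germ_ext fun x hx => by
              refine ((exists_pullback f φ hφ V.unop 1).choose_spec x hx).trans ?_
              rw [show Y.presheaf.germ V.unop (f x) hx 1 = 1 from
                map_one (Y.presheaf.germ V.unop (f x) hx).hom, map_one]
              exact (map_one (X.presheaf.germ _ x hx).hom).symm
            map_mul' := fun s t => germ_ext fun x hx => by
              refine ((exists_pullback f φ hφ V.unop (s * t)).choose_spec x hx).trans ?_
              rw [show Y.presheaf.germ V.unop (f x) hx (s * t) = _ from
                map_mul (Y.presheaf.germ V.unop (f x) hx).hom s t, map_mul]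
              refine (congrArg₂ (· * ·) ((exists_pullback f φ hφ V.unop s).choose_spec x hx)
                ((exists_pullback f φ hφ V.unop t).choose_spec x hx)).symm.trans ?_
              exact (map_mul (X.presheaf.germ _ x hx).hom _ _).symm }
        naturality := fun V W i => by
          ext s
          refine germ_ext fun x hx => ?_
          have hxV : f x ∈ V.unop := i.unop.le hx
          refine ((exists_pullback f φ hφ W.unop (Y.presheaf.map i s)).choose_spec x hx).trans ?_
          have h1 := Y.presheaf.germ_res_apply i.unop (f x) hx s
          have h2 := X.presheaf.germ_res_apply ((Opens.map (TopCat.ofHom f)).map i.unop) x hx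
            (exists_pullback f φ hφ V.unop s).choose
          refine Eq.trans ?_ h2.symm
          refine Eq.trans ?_ ((exists_pullback f φ hφ V.unop s).choose_spec x hxV).symm
          exact congrArg (φ x) h1 } }

theorem germ_homOfStalks (V : Opens Y) (s : Y.presheaf.obj (op V)) (x : X) (hx : f x ∈ V) :
    X.presheaf.germ ((Opens.map (homOfStalks f φ hφ).hom.base).obj V) x hx
      ((homOfStalks f φ hφ).hom.c.app (op V) s) = φ x (Y.presheaf.germ V (f x) hx s) :=
  (exists_pullback f φ hφ V s).choose_spec x hx

theorem germ_c_app (g : X ⟶ Y) (V : Opens Y) (s : Y.presheaf.obj (op V)) (x : X)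
    (hx : g.hom.base x ∈ V) :
    X.presheaf.germ ((Opens.map g.hom.base).obj V) x hx (g.hom.c.app (op V) s) =
      g.hom.stalkMap x (Y.presheaf.germ V (g.hom.base x) hx s) :=
  (ConcreteCategory.congr_hom (PresheafedSpace.stalkMap_germ g.hom V x hx) s).symm

theorem stalkMap_homOfStalks (x : X) (t : Y.presheaf.stalk (f x)) :
    (homOfStalks f φ hφ).hom.stalkMap x t = φ x t := by
  obtain ⟨V, hV, s, rfl⟩ := Y.presheaf.exists_germ_eq t
  exact (germ_c_app (homOfStalks f φ hφ) V s x hV).symm.trans (germ_homOfStalks f φ hφ V s x hV)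

/-- Morphisms agree if they agree on points and on germs of sections. -/
theorem hom_ext_germ {g h : X ⟶ Y} (hb : ∀ x, g.hom.base x = h.hom.base x)
    (hs : ∀ (V : Opens Y) (s : Y.presheaf.obj (op V)) (x : X) (hx : g.hom.base x ∈ V)
      (hx' : h.hom.base x ∈ V),
      X.presheaf.germ ((Opens.map g.hom.base).obj V) x hx (g.hom.c.app (op V) s) =
        X.presheaf.germ ((Opens.map h.hom.base).obj V) x hx' (h.hom.c.app (op V) s)) : g = h := by
  have hb' : g.hom.base = h.hom.base := by
    ext x
    exact hb x
  obtain ⟨⟨gb, gc⟩⟩ := g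
  obtain ⟨⟨gb', hc⟩⟩ := h
  obtain rfl : gb = gb' := hb'
  have : gc = hc := by
    ext V s
    exact germ_ext fun x hx => hs V s x hx hx
  rw [this]

theorem isOpenImmersion_of_bijective (g : X ⟶ Y) (hg : Topology.IsOpenEmbedding g.hom.base)
    (h : ∀ x, Function.Bijective (g.hom.stalkMap x)) : SheafedSpace.IsOpenImmersion g := by
  have : ∀ x, IsIso (g.hom.stalkMap x) := fun x =>
    (ConcreteCategory.isIso_iff_bijective _).2 (h x)
  exact SheafedSpace.IsOpenImmersion.of_stalk_iso g hg

theorem isIso_of_bijective (g : X ⟶ Y) (hg : Topology.IsOpenEmbedding g.hom.base)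
    (hs : Function.Surjective g.hom.base)
    (h : ∀ x, Function.Bijective (g.hom.stalkMap x)) : IsIso g := by
  have := isOpenImmersion_of_bijective g hg h
  have : Epi g.hom.base := (TopCat.epi_iff_surjective _).2 hs
  exact SheafedSpace.IsOpenImmersion.to_iso g

/-- Over a finite space, morphisms are given by maps of stalks compatible with specialization. -/
theorem locally_section_of_finite [Finite X]
    (hc : ∀ {y x : X} (h : y ⤳ x) (t : Y.presheaf.stalk (f x)),
      (stalkSys X).map h (φ x t) = φ y ((stalkSys Y).map (h.map f.continuous) t))
    (V : Opens Y) (s : Y.presheaf.obj (op V)) (x : X) (hx : f x ∈ V) :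
    ∃ (U : Opens X) (_ : x ∈ U) (t : X.presheaf.obj (op U)), ∀ y (hy : y ∈ U) (hy' : f y ∈ V),
      X.presheaf.germ U y hy t = φ y (Y.presheaf.germ V (f y) hy' s) := by
  obtain ⟨t, ht⟩ := exists_germ_minOpen x (φ x (Y.presheaf.germ V (f x) hx s))
  refine ⟨minOpen x, mem_minOpen x, t, fun y hy hy' => ?_⟩
  have h : y ⤳ x := hy
  have h1 := stalkSys_map_germ X h _ (mem_minOpen x) t
  refine h1.symm.trans ?_
  rw [ht, hc h, stalkSys_map_germ]

end HomOfStalks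

/-! ### Affine neighbourhoods -/

section Affine

variable {X : SheafedSpace CommMonCat.{u}}

theorem isUnit_face {M N : Type u} [CommMonoid M] [CommMonoid N] (f : M →* N) (a b : M)
    (h : a * b ∈ (IsUnit.submonoid N).comap f) : a ∈ (IsUnit.submonoid N).comap f := by
  have h : IsUnit (f (a * b)) := h
  rw [map_mul] at h
  exact isUnit_of_mul_isUnit_left h

/-- A finite space with a sheaf of monoids that looks like a spectrum near a point `x` to which
every point specializes is a spectrum. -/
theorem nonempty_iso_spec (hX : (stalkSys X).IsCombinatorial) (x : X) (hx : ∀ y, y ⤳ x) :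
    Nonempty (X ≅ Spec (X.presheaf.stalk x)) := by
  have := hX.finite
  have := hX.t0
  let σ := stalkSys X
  let M := X.presheaf.stalk x
  have hfg : Monoid.FG M := (hX.affine x).fg
  -- The prime of `y` consists of the germs at `x` that do not become units at `y`.
  let p : X → PrimeSpec M := fun y => PrimeSpec.ofFace _ (isUnit_face (σ.map (hx y)))
  have hp : ∀ y m, m ∉ (p y).asIdeal ↔ IsUnit (σ.map (hx y) m) := fun y m =>
    PrimeSpec.notMem_ofFace
  -- In finite spaces the open sets are those stable under generization, so matching the
  -- specialization orders yields a homeomorphism.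
  have hsp : ∀ y z, p y ⤳ p z ↔ y ⤳ z := fun y z => by
    constructor
    · intro h
      refine (hX.affine x).specializes (hx y) (hx z) fun m hm => ?_
      exact (hp y m).1 (PrimeSpec.specializes_iff.1 h m ((hp z m).2 hm))
    · intro h
      refine PrimeSpec.specializes_iff.2 fun m hm => (hp y m).2 ?_
      have := ((hp z m).1 hm).map (σ.map h)
      rwa [σ.map_map] at this
  have hcont : Continuous p := by
    refine continuous_generateFrom_iff.2 ?_
    rintro _ ⟨m, rfl⟩
    refine isOpen_iff_forall_specializes.2 fun y z h hz => ?_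
    exact PrimeSpec.specializes_iff.1 ((hsp y z).2 h) m hz
  have hinj : Function.Injective p := fun y z h =>
    (((hsp y z).1 (specializes_of_eq h)).antisymm ((hsp z y).1 (specializes_of_eq h.symm))).eq
  have hsurj : Function.Surjective p := fun q => by
    obtain ⟨y, h, hy⟩ := (hX.affine x).face q.primeCompl fun a b hab => PrimeSpec.mul_notMem hab
    refine ⟨y, PrimeSpec.ext (SetLike.ext fun m => not_iff_not.1 ?_)⟩
    exact (hp y m).trans (hy m).symm
  have hopen : Topology.IsOpenEmbedding p := by
    refine .of_continuous_injective_isOpenMap hcont hinj fun U hU => ?_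
    have := PrimeSpec.finite_of_fg hfg
    refine isOpen_iff_forall_specializes.2 ?_
    rintro q _ hq ⟨y, hy, rfl⟩
    obtain ⟨z, rfl⟩ := hsurj q
    exact ⟨z, ((hsp z y).1 hq).mem_open hU hy, rfl⟩
  -- Both stalks are localizations of `M` at the same face.
  have hequiv := fun y : X => (Spec.isLoc_toStalk (M := M) (p y)).exists_equiv
    ((hX.affine x).loc (hx y)) fun m => Spec.isUnit_toStalk.trans (hp y m)
  choose e he using hequiv
  let f : C(X, Spec M) := ⟨p, hcont⟩
  let φ : ∀ y : X, (Spec M).presheaf.stalk (f y) →* X.presheaf.stalk y := fun y =>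
    (e y).toMonoidHom
  have hφ := locally_section_of_finite f φ fun {y z} h t => by
    have : (σ.map h).comp (φ z) = (φ y).comp ((stalkSys (Spec M)).map (h.map f.continuous)) := by
      refine (Spec.isLoc_toStalk (M := M) (p z)).hom_ext fun m => ?_
      refine (congrArg (σ.map h) (he z m)).trans ?_
      refine Eq.trans (σ.map_map _ _ _) ((he y m).symm.trans ?_)
      exact congrArg (e y) (Spec.map_toStalk _ m).symm
    exact DFunLike.congr_fun this t
  have := isIso_of_bijective (homOfStalks f φ hφ) hopen hsurj fun y => by
    have : ⇑(ConcreteCategory.hom ((homOfStalks f φ hφ).hom.stalkMap y)) = e y := funext fun t =>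
      stalkMap_homOfStalks f φ hφ y t
    rw [this]
    exact (e y).bijective
  exact ⟨asIso (homOfStalks f φ hφ)⟩

theorem isSpecOn_minOpen (hX : (stalkSys X).IsCombinatorial) [Finite X] (x : X) :
    ∃ M : CommMonCat.{u}, Monoid.FG M ∧ IsSpecOn X (minOpen x) M := by
  let j := localIsoOfOpenImmersion (X.ofRestrict (minOpen x).isOpenEmbedding)
  let x' : X.restrict (minOpen x).isOpenEmbedding := ⟨x, mem_minOpen x⟩
  have hY := j.isCombinatorial' hX
  exact ⟨_, (hY.affine x').fg, nonempty_iso_spec hY x' fun y => j.specializes_iff.1 y.2⟩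

/-- The finitely many smallest neighbourhoods form an affine cover. The combinatorial side visibly
passes to open subspaces, finite covers and products. -/
theorem isFiniteType_iff : IsFiniteType X ↔ (stalkSys X).IsCombinatorial := by
  refine ⟨IsFiniteType.isCombinatorial, fun hX => ?_⟩
  have := hX.finite
  choose M hM using isSpecOn_minOpen hX
  obtain ⟨n, ⟨e⟩⟩ := Finite.exists_equiv_fin X
  refine ⟨n, fun i => minOpen (e.symm i), fun i => M (e.symm i), ?_, fun i => hM _⟩
  refine eq_top_iff.2 fun x _ => Opens.mem_iSup.2 ⟨e x, ?_⟩
  beta_reduce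
  rw [e.symm_apply_apply]
  exact mem_minOpen x

end Affine

/-! ### Locality and smooth monoid schemes -/

/-- All conditions concern generizations of points, and open subspaces are stable under
generization. Isomorphisms are a special case. -/
theorem isSSmooth_of_openImmersion {X Y : SheafedSpace CommMonCat.{u}} (f : X ⟶ Y)
    [SheafedSpace.IsOpenImmersion f] (h : IsSSmooth Y) : IsSSmooth X := by
  let j := localIsoOfOpenImmersion f
  rw [isSSmooth_iff, isFiniteType_iff] at h ⊢
  have hX := j.isCombinatorial' h.1
  exact ⟨hX, fun x => ⟨(j.isSCancellativeAt_iff x).1 (h.2 _).1, j.splitAt' hX.affine x (h.2 _).2⟩⟩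

section Cover

variable {X : SheafedSpace CommMonCat.{u}} {ι : Type v} (U : ι → Opens X) (hU : (⨆ i, U i) = ⊤)

include hU in
theorem isSSmooth_of_cover (hX : IsFiniteType X)
    (h : ∀ i, IsSSmooth (X.restrict (U i).isOpenEmbedding)) : IsSSmooth X := by
  refine isSSmooth_iff.2 ⟨hX, fun x => ?_⟩
  have hx : x ∈ ⨆ i, U i := hU ▸ trivial
  obtain ⟨i, hi⟩ := Opens.mem_iSup.1 hx
  let j := localIsoOfOpenImmersion (X.ofRestrict (U i).isOpenEmbedding)
  have hi' := isSSmooth_iff.1 (h i)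
  have := hi'.2 ⟨x, hi⟩
  exact ⟨(j.isSCancellativeAt_iff ⟨x, hi⟩).2 this.1,
    j.splitAt (isFiniteType_iff.1 hi'.1).affine ⟨x, hi⟩ this.2⟩

include hU in
theorem isFiniteType_of_cover [Finite ι]
    (h : ∀ i, IsFiniteType (X.restrict (U i).isOpenEmbedding)) : IsFiniteType X := by
  refine isFiniteType_iff.2 (Specialization.IsCombinatorial.of_cover
    (fun i => localIsoOfOpenImmersion (X.ofRestrict (U i).isOpenEmbedding)) (fun x => ?_)
    fun i => isFiniteType_iff.1 (h i))
  have hx : x ∈ ⨆ i, U i := hU ▸ trivial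
  obtain ⟨i, hi⟩ := Opens.mem_iSup.1 hx
  exact ⟨i, ⟨x, hi⟩, rfl⟩

end Cover

theorem IsSmooth.isSSmooth {X : SheafedSpace CommMonCat.{u}} (h : IsSmooth X) : IsSSmooth X := by
  have hX := isFiniteType_iff.1 h.1
  refine isSSmooth_iff.2 ⟨h.1, fun x => ?_⟩
  obtain ⟨U, M, r, s, hxU, ⟨e⟩, hM⟩ := h.2 x
  obtain ⟨f, hf, hfU⟩ := hM.exists_openImmersion
  let j := localIsoOfOpenImmersion f
  have hx : x ∈ Set.range j.toFun := by
    change x ∈ Set.range f.hom.base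
    rw [hfU]
    exact hxU
  obtain ⟨p, rfl⟩ := hx
  -- The prime of non-units is the closed point of the chart: all points specialize to it, and its
  -- stalk is `M` itself.
  let p₀ : Spec M := PrimeSpec.ofFace _ (isUnit_face (MonoidHom.id M))
  have hp₀ : ∀ m, m ∉ PrimeSpec.asIdeal p₀ ↔ IsUnit m := fun m => PrimeSpec.notMem_ofFace
  have hp : p ⤳ p₀ := PrimeSpec.specializes_iff.2 fun m hm hmp => by
    obtain ⟨n, hn⟩ := ((hp₀ m).1 hm).exists_right_inv
    exact PrimeSpec.mul_notMem (a := m) (b := n) (by rw [hn]; exact PrimeSpec.one_notMem p) hmp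
  let e₀ : M ≃* (Spec M).presheaf.stalk p₀ := MulEquiv.ofBijective (Spec.toStalk M p₀)
    ((Spec.isLoc_toStalk p₀).bijective fun m hm => (hp₀ m).1 (Spec.isUnit_toStalk.1 hm))
  let c := Specialization.freeCoord (((j.equiv p₀).trans e₀.symm).trans e)
  have ha := hX.affine (j.toFun p₀)
  have hp' : j.toFun p ⤳ j.toFun p₀ := j.specializes_iff.2 hp
  exact ⟨ha.isSCancellativeAt_of_cancel c.cancel hp', (ha.splitAt_of_freeCoord c).of_specializes ha hp'⟩

/-! ### The space with a sheaf of monoids defined by a system on a finite space -/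

section OfSpecialization

variable {P : Type u} [TopologicalSpace P] {A : P → Type u} [∀ p, CommMonoid (A p)]
  (σ : Specialization A)

/-- The sheaf of compatible families. -/
def compatSub : LocalSubmonoid (X := TopCat.of P) A where
  pred {U} f := ∀ (y z : U) (h : y.1 ⤳ z.1), σ.map h (f z) = f y
  res i _ hf y z h := hf ⟨y.1, i.le y.2⟩ ⟨z.1, i.le z.2⟩ h
  locality {U} f hf y z h := by
    obtain ⟨V, hz, i, hV⟩ := hf z
    exact hV ⟨y.1, h.mem_open V.2 hz⟩ ⟨z.1, hz⟩ h
  one_mem _ _ _ _ := map_one _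
  mul_mem {U} f g hf hg y z h := by
    beta_reduce
    rw [map_mul, hf y z h, hg y z h]

/-- The space `P` with the sheaf of compatible families. -/
def ofSpecialization : SheafedSpace CommMonCat.{u} where
  carrier := TopCat.of P
  presheaf := (compatSub σ).presheaf
  IsSheaf := (compatSub σ).isSheaf

instance [Finite P] : Finite (ofSpecialization σ) := inferInstanceAs (Finite P)

variable {σ} in
/-- A point of `P` as a point of the space with its sheaf. -/
abbrev toPt (p : P) : ofSpecialization σ := p

/-- The germ with given value at a point. -/
def toStalkOf [Finite P] (p : P) : A p →* (ofSpecialization σ).presheaf.stalk (toPt p) :=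
  ((ofSpecialization σ).presheaf.germ (minOpen (toPt p)) (toPt p) (mem_minOpen (toPt p))).hom.comp
    { toFun := fun a => ⟨fun y => σ.map y.2 a, fun _ _ _ => σ.map_map _ _ _⟩
      map_one' := Subtype.ext (funext fun y => map_one (σ.map y.2))
      map_mul' := fun _ _ => Subtype.ext (funext fun y => map_mul (σ.map y.2) _ _) }

/-- On the smallest neighbourhood of `p` a compatible family is determined by its value at `p`, so
germs at `p` are elements of `A p`. -/
theorem toStalkOf_value [Finite P] (p : P) (U : Opens (ofSpecialization σ))
    (hp : toPt p ∈ U) (s : (ofSpecialization σ).presheaf.obj (op U)) :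
    toStalkOf σ p (s.1 ⟨p, hp⟩) = (ofSpecialization σ).presheaf.germ U (toPt p) hp s := by
  refine Eq.trans ?_ ((ofSpecialization σ).presheaf.germ_res_apply (homOfLE (minOpen_le hp))
    (toPt p) (mem_minOpen (toPt p)) s)
  refine congrArg ((ofSpecialization σ).presheaf.germ (minOpen (toPt p)) (toPt p)
    (mem_minOpen (toPt p))) ?_
  exact Subtype.ext (funext fun y => s.2 ⟨y.1, minOpen_le hp y.2⟩ ⟨p, hp⟩ y.2)

theorem toStalkOf_bijective [Finite P] (p : P) : Function.Bijective (toStalkOf σ p) := by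
  constructor
  · intro a b h
    obtain ⟨W, hW, i, i', e⟩ := (ofSpecialization σ).presheaf.germ_eq (toPt p) _ _ _ _ h
    have := congrFun (congrArg Subtype.val e) ⟨p, hW⟩
    change σ.map (specializes_refl p) a = σ.map (specializes_refl p) b at this
    rwa [σ.map_refl, σ.map_refl] at this
  · intro t
    obtain ⟨s, rfl⟩ := exists_germ_minOpen (toPt p) t
    exact ⟨_, toStalkOf_value σ p _ _ s⟩

/-- The stalks are the given monoids. -/
def stalkEquiv [Finite P] (p : P) : A p ≃* (ofSpecialization σ).presheaf.stalk (toPt p) :=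
  MulEquiv.ofBijective (toStalkOf σ p) (toStalkOf_bijective σ p)

theorem map_stalkEquiv [Finite P] {q p : P} (h : q ⤳ p) (a : A p) :
    (stalkSys (ofSpecialization σ)).map (y := toPt q) (x := toPt p) h (stalkEquiv σ p a) =
      stalkEquiv σ q (σ.map h a) := by
  refine (stalkSys_map_germ (ofSpecialization σ) (y := toPt q) (x := toPt p) h _ _ _).trans ?_
  exact (toStalkOf_value σ q _ _ _).symm

/-- The stalk system of the space defined by a system. -/
def localIsoOfSpecialization [Finite P] : σ.LocalIso (stalkSys (ofSpecialization σ)) where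
  toFun p := p
  isOpenEmbedding := Topology.IsOpenEmbedding.id
  equiv p := (stalkEquiv σ p).symm
  equiv_map {y x} h b := by
    obtain ⟨a, rfl⟩ := (stalkEquiv σ x).surjective b
    refine (congrArg (stalkEquiv σ y).symm (map_stalkEquiv σ h a)).trans ?_
    refine ((stalkEquiv σ y).symm_apply_apply _).trans ?_
    exact congrArg (σ.map h) ((stalkEquiv σ x).symm_apply_apply a).symm

theorem isCombinatorial_ofSpecialization (h : σ.IsCombinatorial) :
    (stalkSys (ofSpecialization σ)).IsCombinatorial :=
  have := h.finite
  Specialization.IsCombinatorial.of_cover (ι := Unit) (fun _ => localIsoOfSpecialization σ)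
    (fun x => ⟨(), x, rfl⟩) fun _ => h

end OfSpecialization

/-! ### Products of monoid schemes of finite type -/

theorem hom_ext_stalk {X Y : SheafedSpace CommMonCat.{u}} {g h : X ⟶ Y}
    (hb : ∀ x, g.hom.base x = h.hom.base x)
    (hs : ∀ (V : Opens Y) (s : Y.presheaf.obj (op V)) (x : X) (hx : g.hom.base x ∈ V)
      (hx' : h.hom.base x ∈ V), g.hom.stalkMap x (Y.presheaf.germ V _ hx s) =
        h.hom.stalkMap x (Y.presheaf.germ V _ hx' s)) : g = h :=
  hom_ext_germ hb fun V s x hx hx' => (germ_c_app g V s x hx).trans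
    ((hs V s x hx hx').trans (germ_c_app h V s x hx').symm)

theorem stalkMap_germ_congr {X Y : SheafedSpace CommMonCat.{u}} {g h : X ⟶ Y} (e : g = h)
    (V : Opens Y) (s : Y.presheaf.obj (op V)) (x : X) (hx : g.hom.base x ∈ V)
    (hx' : h.hom.base x ∈ V) : g.hom.stalkMap x (Y.presheaf.germ V _ hx s) =
      h.hom.stalkMap x (Y.presheaf.germ V _ hx' s) := by
  subst e
  rfl

theorem stalkMap_comp_apply {X Y Z : SheafedSpace CommMonCat.{u}} (g : X ⟶ Y) (h : Y ⟶ Z) (x : X)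
    (t : Z.presheaf.stalk (h.hom.base (g.hom.base x))) :
    (g ≫ h).hom.stalkMap x t = g.hom.stalkMap x (h.hom.stalkMap (g.hom.base x) t) :=
  ConcreteCategory.congr_hom (PresheafedSpace.stalkMap.comp g.hom h.hom x) t

section Product

variable (X Y : SheafedSpace CommMonCat.{u})

/-- The product of two finite spaces with sheaves of monoids. -/
abbrev prodSpace : SheafedSpace CommMonCat.{u} := ofSpecialization ((stalkSys X).prod (stalkSys Y))

variable [Finite X] [Finite Y]

/-- The stalks of the product. -/
def prodStalk (p : X × Y) : X.presheaf.stalk p.1 × Y.presheaf.stalk p.2 ≃*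
    (prodSpace X Y).presheaf.stalk (toPt p) :=
  stalkEquiv ((stalkSys X).prod (stalkSys Y)) p

/-- The first projection. -/
def prodFst : prodSpace X Y ⟶ X :=
  homOfStalks (X := prodSpace X Y) (⟨Prod.fst, continuous_fst⟩ : C(X × Y, X))
    (fun p => (prodStalk X Y p).toMonoidHom.comp (MonoidHom.inl _ _))
    (locally_section_of_finite (X := prodSpace X Y) _ _ fun h t => by
      refine (map_stalkEquiv ((stalkSys X).prod (stalkSys Y)) h (t, 1)).trans ?_
      refine congrArg (stalkEquiv ((stalkSys X).prod (stalkSys Y)) _) ?_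
      exact Prod.ext rfl (map_one ((stalkSys Y).map (specializes_prod.1 h).2)))

/-- The second projection. -/
def prodSnd : prodSpace X Y ⟶ Y :=
  homOfStalks (X := prodSpace X Y) (⟨Prod.snd, continuous_snd⟩ : C(X × Y, Y))
    (fun p => (prodStalk X Y p).toMonoidHom.comp (MonoidHom.inr _ _))
    (locally_section_of_finite (X := prodSpace X Y) _ _ fun h t => by
      refine (map_stalkEquiv ((stalkSys X).prod (stalkSys Y)) h (1, t)).trans ?_
      refine congrArg (stalkEquiv ((stalkSys X).prod (stalkSys Y)) _) ?_
      exact Prod.ext (map_one ((stalkSys X).map (specializes_prod.1 h).1)) rfl)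

theorem stalkMap_prodFst (p : X × Y) (t : X.presheaf.stalk p.1) :
    (prodFst X Y).hom.stalkMap (toPt p) t = prodStalk X Y p (t, 1) :=
  stalkMap_homOfStalks (X := prodSpace X Y) (⟨Prod.fst, continuous_fst⟩ : C(X × Y, X)) _ _ p t

theorem stalkMap_prodSnd (p : X × Y) (t : Y.presheaf.stalk p.2) :
    (prodSnd X Y).hom.stalkMap (toPt p) t = prodStalk X Y p (1, t) :=
  stalkMap_homOfStalks (X := prodSpace X Y) (⟨Prod.snd, continuous_snd⟩ : C(X × Y, Y)) _ _ p t

variable {X Y} {Z : SheafedSpace CommMonCat.{u}} (f : Z ⟶ X) (g : Z ⟶ Y)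

/-- The map of spaces underlying a morphism to the product. -/
def liftBase : C(Z, X × Y) :=
  ⟨fun z => (f.hom.base z, g.hom.base z), f.hom.base.hom.continuous.prodMk g.hom.base.hom.continuous⟩

/-- The maps of stalks underlying a morphism to the product. -/
def liftStalk (z : Z) : (prodSpace X Y).presheaf.stalk
    (toPt (liftBase f g z)) →* Z.presheaf.stalk z :=
  (MonoidHom.coprod (f.hom.stalkMap z).hom (g.hom.stalkMap z).hom).comp
    (prodStalk X Y (liftBase f g z)).symm.toMonoidHom

theorem liftStalk_prodStalk (z : Z) (a : X.presheaf.stalk (f.hom.base z))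
    (b : Y.presheaf.stalk (g.hom.base z)) :
    liftStalk f g z (prodStalk X Y (liftBase f g z) (a, b)) =
      f.hom.stalkMap z a * g.hom.stalkMap z b := by
  change MonoidHom.coprod (f.hom.stalkMap z).hom (g.hom.stalkMap z).hom
    ((prodStalk X Y (liftBase f g z)).symm (prodStalk X Y (liftBase f g z) (a, b))) = _
  rw [MulEquiv.symm_apply_apply]
  rfl

/-- Germs of sections over the product are locally products of germs. -/
theorem exists_germ_prod (V : Opens (prodSpace X Y)) (s : (prodSpace X Y).presheaf.obj (op V))
    (p : X × Y) (hp : p ∈ V) :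
    ∃ (a : X.presheaf.obj (op (minOpen p.1))) (b : Y.presheaf.obj (op (minOpen p.2))),
      ∀ (q : X × Y) (hq : q ∈ V) (h1 : q.1 ∈ minOpen p.1) (h2 : q.2 ∈ minOpen p.2),
        (prodSpace X Y).presheaf.germ V q hq s = prodStalk X Y q
          (X.presheaf.germ (minOpen p.1) q.1 h1 a, Y.presheaf.germ (minOpen p.2) q.2 h2 b) := by
  obtain ⟨a, ha⟩ := exists_germ_minOpen p.1 (s.1 ⟨p, hp⟩).1
  obtain ⟨b, hb⟩ := exists_germ_minOpen p.2 (s.1 ⟨p, hp⟩).2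
  refine ⟨a, b, fun q hq h1 h2 => ?_⟩
  have hqp : q ⤳ p := specializes_prod.2 ⟨h1, h2⟩
  refine (toStalkOf_value ((stalkSys X).prod (stalkSys Y)) q V hq s).symm.trans ?_
  refine congrArg (prodStalk X Y q) ?_
  refine (s.2 ⟨q, hq⟩ ⟨p, hp⟩ hqp).symm.trans (Prod.ext ?_ ?_)
  · refine (congrArg ((stalkSys X).map (specializes_prod.1 hqp).1) ha.symm).trans ?_
    exact stalkSys_map_germ X _ _ _ a
  · refine (congrArg ((stalkSys Y).map (specializes_prod.1 hqp).2) hb.symm).trans ?_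
    exact stalkSys_map_germ Y _ _ _ b

theorem liftStalk_locally (V : Opens (prodSpace X Y)) (s : (prodSpace X Y).presheaf.obj (op V))
    (z : Z) (hz : liftBase f g z ∈ V) :
    ∃ (U : Opens Z) (_ : z ∈ U) (t : Z.presheaf.obj (op U)), ∀ y (hy : y ∈ U)
      (hy' : liftBase f g y ∈ V), Z.presheaf.germ U y hy t =
        liftStalk f g y ((prodSpace X Y).presheaf.germ V (liftBase f g y) hy' s) := by
  obtain ⟨a, b, h⟩ := exists_germ_prod V s _ hz
  let U₁ := (Opens.map f.hom.base).obj (minOpen (f.hom.base z))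
  let U₂ := (Opens.map g.hom.base).obj (minOpen (g.hom.base z))
  refine ⟨U₁ ⊓ U₂, ⟨mem_minOpen (f.hom.base z), mem_minOpen (g.hom.base z)⟩,
    -- Near `z`, the section of the product is a pair `(a, b)`; its pullback is the product of the
    -- pullbacks of `a` and `b`.
    Z.presheaf.map (homOfLE inf_le_left).op (f.hom.c.app _ a) *
      Z.presheaf.map (homOfLE inf_le_right).op (g.hom.c.app _ b), fun y hy hy' => ?_⟩
  rw [h _ hy' hy.1 hy.2]
  refine Eq.trans ?_ (liftStalk_prodStalk f g y _ _).symm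
  refine (map_mul (Z.presheaf.germ (U₁ ⊓ U₂) y hy).hom _ _).trans (congrArg₂ (· * ·) ?_ ?_)
  · exact (Z.presheaf.germ_res_apply (homOfLE inf_le_left : U₁ ⊓ U₂ ⟶ U₁) y hy _).trans
      (germ_c_app f _ a y hy.1)
  · exact (Z.presheaf.germ_res_apply (homOfLE inf_le_right : U₁ ⊓ U₂ ⟶ U₂) y hy _).trans
      (germ_c_app g _ b y hy.2)

/-- The morphism to the product with given components. -/
def prodLift : Z ⟶ prodSpace X Y :=
  homOfStalks (Y := prodSpace X Y) (liftBase f g) (liftStalk f g) (liftStalk_locally f g)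

theorem stalkMap_prodLift (z : Z) (a : X.presheaf.stalk (f.hom.base z))
    (b : Y.presheaf.stalk (g.hom.base z)) :
    (prodLift f g).hom.stalkMap z (prodStalk X Y (liftBase f g z) (a, b)) =
      f.hom.stalkMap z a * g.hom.stalkMap z b :=
  (stalkMap_homOfStalks (Y := prodSpace X Y) (liftBase f g) (liftStalk f g) (liftStalk_locally f g)
    z _).trans (liftStalk_prodStalk f g z a b)

theorem prodLift_fst : prodLift f g ≫ prodFst X Y = f := by
  refine hom_ext_stalk (fun z => rfl) fun V s z hz hz' => ?_
  refine (stalkMap_comp_apply _ _ _ _).trans ?_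
  refine (congrArg ((prodLift f g).hom.stalkMap z) (stalkMap_prodFst X Y _ _)).trans ?_
  refine (stalkMap_prodLift f g z _ _).trans ?_
  refine (congrArg (_ * ·) (map_one (g.hom.stalkMap z).hom)).trans ?_
  exact mul_one _

theorem prodLift_snd : prodLift f g ≫ prodSnd X Y = g := by
  refine hom_ext_stalk (fun z => rfl) fun V s z hz hz' => ?_
  refine (stalkMap_comp_apply _ _ _ _).trans ?_
  refine (congrArg ((prodLift f g).hom.stalkMap z) (stalkMap_prodSnd X Y _ _)).trans ?_
  refine (stalkMap_prodLift f g z _ _).trans ?_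
  refine (congrArg (· * _) (map_one (f.hom.stalkMap z).hom)).trans ?_
  exact one_mul _

/-- Every germ on the product is a product of germs pulled back from the factors, so the components
determine the stalk maps. -/
theorem prod_hom_ext {m m' : Z ⟶ prodSpace X Y} (h1 : m ≫ prodFst X Y = m' ≫ prodFst X Y)
    (h2 : m ≫ prodSnd X Y = m' ≫ prodSnd X Y) : m = m' := by
  have hb : ∀ z, m.hom.base z = m'.hom.base z := fun z => Prod.ext
    (congrArg (fun k : Z ⟶ X => k.hom.base z) h1) (congrArg (fun k : Z ⟶ Y => k.hom.base z) h2)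
  refine hom_ext_stalk hb fun V s z hz hz' => ?_
  obtain ⟨a, b, h⟩ := exists_germ_prod V s _ hz
  -- Stated for a general `k`, with `a` and `b` fixed by `m`, so that it applies to both `m` and
  -- `m'`.
  have key : ∀ (k : Z ⟶ prodSpace X Y) (hk : k.hom.base z ∈ V)
      (hk1 : (k ≫ prodFst X Y).hom.base z ∈ minOpen (Prod.fst (m.hom.base z)))
      (hk2 : (k ≫ prodSnd X Y).hom.base z ∈ minOpen (Prod.snd (m.hom.base z))),
      k.hom.stalkMap z ((prodSpace X Y).presheaf.germ V _ hk s) =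
        (k ≫ prodFst X Y).hom.stalkMap z (X.presheaf.germ _ _ hk1 a) *
          (k ≫ prodSnd X Y).hom.stalkMap z (Y.presheaf.germ _ _ hk2 b) := by
    intro k hk hk1 hk2
    refine Eq.trans ?_ (congrArg₂ (· * ·) (stalkMap_comp_apply k (prodFst X Y) z _)
      (stalkMap_comp_apply k (prodSnd X Y) z _)).symm
    refine Eq.trans ?_ (map_mul (k.hom.stalkMap z).hom _ _)
    refine congrArg (k.hom.stalkMap z) ((h _ hk hk1 hk2).trans ?_)
    refine Eq.trans ?_ (congrArg₂ (· * ·) (stalkMap_prodFst X Y _ _)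
      (stalkMap_prodSnd X Y _ _)).symm
    refine Eq.trans ?_ (map_mul (prodStalk X Y (k.hom.base z)) _ _)
    refine congrArg (prodStalk X Y (k.hom.base z)) (Prod.ext ?_ ?_)
    · exact (mul_one _).symm
    · exact (one_mul _).symm
  have m1 : (m ≫ prodFst X Y).hom.base z ∈ minOpen (Prod.fst (m.hom.base z)) :=
    mem_minOpen (Prod.fst (m.hom.base z))
  have m2 : (m ≫ prodSnd X Y).hom.base z ∈ minOpen (Prod.snd (m.hom.base z)) :=
    mem_minOpen (Prod.snd (m.hom.base z))
  have m1' : (m' ≫ prodFst X Y).hom.base z ∈ minOpen (Prod.fst (m.hom.base z)) := h1 ▸ m1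
  have m2' : (m' ≫ prodSnd X Y).hom.base z ∈ minOpen (Prod.snd (m.hom.base z)) := h2 ▸ m2
  refine (key m hz m1 m2).trans (Eq.trans ?_ (key m' hz' m1' m2').symm)
  exact congrArg₂ (· * ·) (stalkMap_germ_congr h1 _ a z m1 m1') (stalkMap_germ_congr h2 _ b z m2 m2')

end Product

/-! ### The product in the category of monoid schemes -/

section SchemeProduct

theorem isCombinatorial_prodSpace {X Y : SheafedSpace CommMonCat.{u}}
    (hX : (stalkSys X).IsCombinatorial) (hY : (stalkSys Y).IsCombinatorial) :
    (stalkSys (prodSpace X Y)).IsCombinatorial :=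
  isCombinatorial_ofSpecialization _ (hX.prod hY)

theorem isSSmooth_prodSpace {X Y : SheafedSpace CommMonCat.{u}} (hX : IsSSmooth X)
    (hY : IsSSmooth Y) : IsSSmooth (prodSpace X Y) := by
  rw [isSSmooth_iff, isFiniteType_iff] at hX hY ⊢
  have := hX.1.finite
  have := hY.1.finite
  let j := localIsoOfSpecialization ((stalkSys X).prod (stalkSys Y))
  refine ⟨isCombinatorial_prodSpace hX.1 hY.1, fun p => ⟨?_, ?_⟩⟩
  · exact (j.isSCancellativeAt_iff p).2 ((hX.2 p.1).1.prod (hY.2 p.2).1)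
  · exact j.splitAt (hX.1.prod hY.1).affine p
      (.prod hX.1.affine hY.1.affine (hX.2 p.1).2 (hY.2 p.2).2)

variable (X Y : MonoidScheme.{u}) (hX : (stalkSys X.toSheafedSpace).IsCombinatorial)
  (hY : (stalkSys Y.toSheafedSpace).IsCombinatorial)

/-- The product of two monoid schemes of finite type. -/
def prodScheme : MonoidScheme.{u} where
  toSheafedSpace := prodSpace X.toSheafedSpace Y.toSheafedSpace
  local_affine x := by
    have hP := isCombinatorial_prodSpace hX hY
    have := hP.finite
    obtain ⟨M, -, hM⟩ := isSpecOn_minOpen hP x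
    exact ⟨_, M, mem_minOpen x, hM⟩

/-- The product as a binary fan. -/
def prodFan : BinaryFan X Y :=
  have := hX.finite
  have := hY.finite
  BinaryFan.mk (P := prodScheme X Y hX hY)
    (show Hom _ _ from ⟨prodFst X.toSheafedSpace Y.toSheafedSpace, fun p => ⟨fun a ha => by
      have ha : IsUnit (prodStalk X.toSheafedSpace Y.toSheafedSpace p (a, 1)) :=
        (stalkMap_prodFst X.toSheafedSpace Y.toSheafedSpace p a) ▸ ha
      rw [MulEquiv.isUnit_map] at ha
      exact (Prod.isUnit_iff.1 ha).1⟩⟩)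
    (show Hom _ _ from ⟨prodSnd X.toSheafedSpace Y.toSheafedSpace, fun p => ⟨fun a ha => by
      have ha : IsUnit (prodStalk X.toSheafedSpace Y.toSheafedSpace p (1, a)) :=
        (stalkMap_prodSnd X.toSheafedSpace Y.toSheafedSpace p a) ▸ ha
      rw [MulEquiv.isUnit_map] at ha
      exact (Prod.isUnit_iff.1 ha).2⟩⟩)

variable {X Y} in
/-- The morphism of monoid schemes with given components. -/
def prodSchemeLift {Z : MonoidScheme.{u}} (f : Hom Z X) (g : Hom Z Y) :
    Hom Z (prodScheme X Y hX hY) :=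
  have := hX.finite
  have := hY.finite
  ⟨prodLift f.hom g.hom, fun z => ⟨fun t ht => by
    obtain ⟨⟨a, b⟩, rfl⟩ := (prodStalk X.toSheafedSpace Y.toSheafedSpace
      (liftBase f.hom g.hom z)).surjective t
    -- The stalk map is the product of the two component maps, and a product is a unit only if both
    -- factors are; locality of `f` and `g` then applies.
    have ht : IsUnit (f.hom.hom.stalkMap z a * g.hom.hom.stalkMap z b) :=
      (stalkMap_prodLift f.hom g.hom z a b) ▸ ht
    have h1 := (f.isLocal z).map_nonunit a (isUnit_of_mul_isUnit_left ht)
    have h2 := (g.isLocal z).map_nonunit b (isUnit_of_mul_isUnit_right ht)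
    exact (Prod.isUnit_iff.2 ⟨h1, h2⟩ : IsUnit (a, b)).map
      (prodStalk X.toSheafedSpace Y.toSheafedSpace (liftBase f.hom g.hom z))⟩⟩

/-- The product is a categorical product. -/
def prodFanIsLimit : IsLimit (prodFan X Y hX hY) :=
  have := hX.finite
  have := hY.finite
  BinaryFan.IsLimit.mk _ (fun f g => prodSchemeLift hX hY f g)
    (fun f g => Hom.ext (prodLift_fst (Hom.hom f) (Hom.hom g)))
    (fun f g => Hom.ext (prodLift_snd (Hom.hom f) (Hom.hom g)))
    (fun f g _ h1 h2 => Hom.ext (prod_hom_ext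
      ((congrArg Hom.hom h1).trans (prodLift_fst (Hom.hom f) (Hom.hom g)).symm)
      ((congrArg Hom.hom h2).trans (prodLift_snd (Hom.hom f) (Hom.hom g)).symm)))

/-- Isomorphic monoid schemes have isomorphic underlying spaces with sheaves of monoids. -/
def sheafedSpaceIso {X Y : MonoidScheme.{u}} (e : X ≅ Y) : X.toSheafedSpace ≅ Y.toSheafedSpace where
  hom := Hom.hom e.hom
  inv := Hom.hom e.inv
  hom_inv_id := congrArg Hom.hom e.hom_inv_id
  inv_hom_id := congrArg Hom.hom e.inv_hom_id

end SchemeProduct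

end

end MonSch

/-! ### The main theorem -/

open MonSch
theorem mainTheorem9 :
    (∀ (X : MonoidScheme.{u}) (ι : Type v) (U : ι → Opens X.toSheafedSpace),
      (⨆ i, U i) = ⊤ →
      ((IsSSmooth X.toSheafedSpace ↔ IsFiniteType X.toSheafedSpace ∧
          ∀ i, IsSSmooth (X.toSheafedSpace.restrict (U i).isOpenEmbedding)) ∧
        (Finite ι → (IsSSmooth X.toSheafedSpace ↔
          ∀ i, IsSSmooth (X.toSheafedSpace.restrict (U i).isOpenEmbedding))))) ∧
    (∀ X Y : MonoidScheme.{u}, IsSSmooth X.toSheafedSpace → IsSSmooth Y.toSheafedSpace →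
      HasBinaryProduct X Y ∧
        ∀ P : BinaryFan X Y, IsLimit P → IsSSmooth P.pt.toSheafedSpace) ∧
    (∀ X : MonoidScheme.{u}, IsSmooth X.toSheafedSpace → IsSSmooth X.toSheafedSpace) := by
  refine ⟨fun X ι U hU => ?_, fun X Y hX hY => ?_, fun X hX => hX.isSSmooth⟩
  · have key := fun (h : IsSSmooth X.toSheafedSpace) i =>
      isSSmooth_of_openImmersion (X.toSheafedSpace.ofRestrict (U i).isOpenEmbedding) h
    refine ⟨⟨fun h => ⟨h.1, key h⟩, fun h => isSSmooth_of_cover U hU h.1 h.2⟩,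
      fun _ => ⟨key, fun h => ?_⟩⟩
    exact isSSmooth_of_cover U hU (isFiniteType_of_cover U hU fun i => (h i).1) h
  · have hX' := hX.1.isCombinatorial
    have hY' := hY.1.isCombinatorial
    have hlim := prodFanIsLimit X Y hX' hY'
    refine ⟨⟨⟨⟨_, hlim⟩⟩⟩, fun P hP => ?_⟩
    -- Any product is isomorphic to the constructed one, and `s`-smoothness passes along the
    -- isomorphism.
    exact isSSmooth_of_openImmersion
      (sheafedSpaceIso (hP.conePointUniqueUpToIso hlim)).hom (isSSmooth_prodSpace hX hY)
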